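/- **Theorem.** Let $\nu\in\mathbb N$, $\lambda\in\mathbb C^\nu$, and let $H=\sum_{i=1}^\nu\lambda_ix_iy_i+\sum_{(n,m)\in A(H)}a_{nm}x^ny^m\in\mathbb C[[x,y]]$ be a formal Hamiltonian, where $x=(x_1,\dots,x_\nu)$, $y=(y_1,\dots,y_\nu)$ and $A(H)$ is the set of exponents of the (nonzero) monomials of total degree $|n|+|m|\ge 3$. Vector fields are regarded as operators on $\mathbb C[[x,y]]$, and $X_f=\sum_i(\partial_{x_i}f\,\partial_{y_i}-\partial_{y_i}f\,\partial_{x_i})$, $X_{\rm lin}=\sum_i\lambda_i(y_i\partial_{y_i}-x_i\partial_{x_i})$. Put $\omega(n,m)=\sum_j\lambda_j(m_j-n_j)$, $\Omega(H)=\{\omega(n,m):(n,m)\in A(H)\}\subset\mathbb C$, and for $\omega\in\Omega(H)$ $$H_\omega=\sum_{(n,m)\in A(H),\ \omega(n,m)=\omega}a_{nm}x^ny^m,\qquad \mathfrak D_\omega=X_{H_\omega};$$ for a word $\boldsymbol\omega=\omega_1\cdots\omega_r$ put $\mathfrak D_{\boldsymbol\omega}=\mathfrak D_{\omega_1}\circ\cdots\circ\mathfrak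 D_{\omega_r}$ and $\|\boldsymbol\omega\|=\omega_1+\cdots+\omega_r$. Moulds are complex-valued functions $M^{\bullet}$ on words with letters in $\mathbb C$, with $(M\times N)^{\boldsymbol\omega}=\sum_{\boldsymbol\omega^1\boldsymbol\omega^2=\boldsymbol\omega}M^{\boldsymbol\omega^1}N^{\boldsymbol\omega^2}$, $\operatorname{Exp}M=\sum_{k\ge0}M^{\times k}/k!$ (when $M^\emptyset=0$), $(\nabla M)^{\boldsymbol\omega}=\|\boldsymbol\omega\|M^{\boldsymbol\omega}$, and composition $(M\circ N)^\emptyset=M^\emptyset$, $$(M\circ N)^{\boldsymbol\omega}=\sum_{k\ge1}\ \sum_{\boldsymbol\omega^1\cdots\boldsymbol\omega^k=\boldsymbol\omega,\ \boldsymbol\omega^i\ne\emptyset}M^{\|\boldsymbol\omega^1\|\cdots\|\boldsymbol\omega^k\|}N^{\boldsymbol\omega^1}\cdots N^{\boldsymbol\omega^k}\qquad(\boldsymbol\omega\neq\emptyset).$$ Let $I^{\boldsymbol\omega}=1$ on words of length $1$ and $0$ otherwise; let $V^{\boldsymbol\omega}=1/\omega$ on one-letter words $\boldsymbol\omega=\omega\neq0$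 and $0$ otherwise; $$\mathrm{Sam}=\operatorname{Exp}V\times I\times\operatorname{Exp}(-V)-\nabla(\operatorname{Exp}V)\times\operatorname{Exp}(-V);$$ let $\mathrm{Sam}^{\circ r}=\mathrm{Sam}\circ\cdots\circ\mathrm{Sam}$ ($r$ factors, $\mathrm{Sam}^{\circ0}=I$), and let $\mathrm{Tram}^{\boldsymbol\omega}=(\mathrm{Sam}^{\circ r})^{\boldsymbol\omega}$ for $\boldsymbol\omega$ of length $r$. The simplification of a Hamiltonian $K$ of the same form as $H$ (same $\lambda$) is given by $\Theta_K=\exp\big(\sum_{\omega\in\Omega(K),\,\omega\ne0}\tfrac1\omega X_{K_\omega}\big)$, which replaces $X_K$ by $\Theta_K\,X_K\,\exp\big(-\sum_{\omega\in\Omega(K),\,\omega\ne0}\tfrac1\omega X_{K_\omega}\big)$. All infinite sums and limits of operators are formal: for each argument and each coefficient of the result, only finitely many terms are nonzero, respectively the sequence is eventually constant. Then: 1. $X_H=X_{\rm lin}+\sum_{\omega\in\Omega(H)}\mathfrak D_\omega$, a formally convergent sum. 2. There is exactly one sequence $H=H^{(0)},H^{(1)},H^{(2)},\dots$ of Hamiltonians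 of the form $\sum_i\lambda_ix_iy_i+(\text{terms of degree}\ge3)$ such that, for every $r$, $X_{H^{(r+1)}}$ is the simplification of $X_{H^{(r)}}$. 3. Each $\Theta_r=\Theta_{H^{(r)}}$ is a canonical transformation: it is the substitution $\varphi\mapsto\varphi\circ h_r$ of a formal change of variables $h_r$ tangent to the identity, it is bijective with inverse $\exp\big(-\sum_{\omega\ne0}\tfrac1\omega X_{H^{(r)}_\omega}\big)$, it preserves Poisson brackets, and $\Theta_rX_K\Theta_r^{-1}=X_{\Theta_rK}$ for every $K\in\mathbb C[[x,y]]$. 4. $(\mathrm{Sam}^{\circ p})^{\boldsymbol\omega}=\mathrm{Tram}^{\boldsymbol\omega}$ for every word $\boldsymbol\omega$ and every $p$ at least the length of $\boldsymbol\omega$; thus $\mathrm{Tram}=\lim_p\mathrm{Sam}^{\circ p}$. 5. The trimmed form of $X_H$, i.e. the limit $X_{\rm tram}=\lim_{r\to\infty}X_{H^{(r)}}$ of the simplification procedure, exists and is $$X_{\rm tram}=X_{\rm lin}+\sum_{\boldsymbol\omega}\mathrm{Tram}^{\boldsymbol\omega}\,\mathfrak D_{\boldsymbol\omega},$$ the formally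 convergent sum over all words $\boldsymbol\omega$ in the alphabet $\Omega(H)$. -/

import Mathlib

noncomputable section

namespace HamMould

/-! ## Moulds -/

/-- A `K`-valued mould on the alphabet `A`: a map from words to `K`. -/
abbrev Mould (A K : Type*) := List A → K

/-- Mould product: sum over all cuttings of the word into two (possibly empty) words. -/
def Mould.prod {A K : Type*} [CommRing K] (M N : Mould A K) : Mould A K :=
  fun w => ∑ k ∈ Finset.range (w.length + 1), M (w.take k) * N (w.drop k)

/-- Neutral element of the mould product. -/
def Mould.one {A K : Type*} [CommRing K] : Mould A K
  | [] => 1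
  | _ => 0

/-- Neutral element of the mould composition. -/
def Mould.ident {A K : Type*} [CommRing K] : Mould A K
  | [_] => 1
  | _ => 0

/-- Powers for the mould product. -/
def Mould.npow {A K : Type*} [CommRing K] (M : Mould A K) : ℕ → Mould A K
  | 0 => Mould.one
  | n + 1 => (M.npow n).prod M

/-- Exponential `∑ M^{×n} / n!` of a mould with `M^∅ = 0`: on a word of length `ℓ` the powers of
exponent larger than `ℓ` vanish. -/
def Mould.exp {A K : Type*} [Field K] (M : Mould A K) : Mould A K :=
  fun w => ∑ n ∈ Finset.range (w.length + 1), M.npow n w / (Nat.factorial n : K)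

/-- Mould composition: sum over all cuttings of the word into nonempty words `w¹ ⋯ wᵏ` of
`M^{‖w¹‖ ⋯ ‖wᵏ‖} N^{w¹} ⋯ N^{wᵏ}`, where `‖·‖` is the sum of the letters.
On the empty word this is `M^∅`. -/
def Mould.comp {A K : Type*} [AddMonoid A] [CommRing K] (M N : Mould A K) : Mould A K :=
  fun w => ∑ c : Composition w.length,
    M ((w.splitWrtComposition c).map List.sum) * ((w.splitWrtComposition c).map N).prod

/-- The operator `∇`, `(∇M)^w = ‖w‖ M^w`, for moulds on complex letters. -/
def Mould.nabla (M : Mould ℂ ℂ) : Mould ℂ ℂ := fun w => w.sum * M w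

/-- The mould `V`: `1/ω` on a word of one nonzero letter `ω`, and `0` otherwise. -/
def vMould : Mould ℂ ℂ
  | [ω] => if ω = 0 then 0 else 1 / ω
  | _ => 0

/-- The simplification mould `Sam = Exp V × I × Exp(-V) - ∇(Exp V) × Exp(-V)`. -/
def sam : Mould ℂ ℂ :=
  (vMould.exp.prod Mould.ident).prod (Mould.exp (-vMould))
    - vMould.exp.nabla.prod (Mould.exp (-vMould))

/-- `Sam ∘ ⋯ ∘ Sam`, with `r` factors. -/
def samIter : ℕ → Mould ℂ ℂ
  | 0 => Mould.ident
  | r + 1 => Mould.comp (samIter r) sam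

/-- The mould `Tram`: on a word of length `r` it is the `r`-fold composition of `Sam`. -/
def tram : Mould ℂ ℂ := fun w => samIter w.length w

/-! ## Formal power series in `x₁, …, x_ν, y₁, …, y_ν` and operators on them -/

/-- The variables: `Sum.inl i` is `x_i` and `Sum.inr i` is `y_i`. -/
abbrev Var (ν : ℕ) := Fin ν ⊕ Fin ν

/-- `ℂ[[x, y]]`. -/
abbrev PS (ν : ℕ) := MvPowerSeries (Var ν) ℂ

/-- Operators on `ℂ[[x, y]]`. -/
abbrev Op (ν : ℕ) := PS ν → PS ν

variable {ν : ℕ}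

/-- The family `c i • T i` of operators is formally summable: every coefficient of the image of
every series receives only finitely many nonzero contributions. -/
def FormallySummable {ι : Type*} (c : ι → ℂ) (T : ι → Op ν) : Prop :=
  ∀ (φ : PS ν) (d : Var ν →₀ ℕ),
    (Function.support fun i => c i * MvPowerSeries.coeff d (T i φ)).Finite

/-- The formal sum `∑ c i • T i`, computed coefficientwise. -/
def formalSum {ι : Type*} (c : ι → ℂ) (T : ι → Op ν) : Op ν :=
  fun φ d => ∑ᶠ i, c i * MvPowerSeries.coeff d (T i φ)

/-- The exponential `∑ Vⁿ / n!` of an operator, computed coefficientwise. -/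
def expOp (V : Op ν) : Op ν :=
  formalSum (fun n : ℕ => 1 / (Nat.factorial n : ℂ)) (fun n => V^[n])

/-- Formal (coefficientwise stationary) convergence of a sequence of operators. -/
def FormalLimit (T : ℕ → Op ν) (S : Op ν) : Prop :=
  ∀ (φ : PS ν) (d : Var ν →₀ ℕ), ∀ᶠ r in Filter.atTop,
    MvPowerSeries.coeff d (T r φ) = MvPowerSeries.coeff d (S φ)

/-- The composed operator `D_{a₁} ∘ ⋯ ∘ D_{a_r}` attached to a word. -/
def wordOp {A : Type*} (D : A → Op ν) : List A → Op ν
  | [] => id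
  | a :: w => D a ∘ wordOp D w

/-- The Poisson bracket `{f, g} = ∑ (∂f/∂x_i ∂g/∂y_i - ∂f/∂y_i ∂g/∂x_i)`. -/
def poisson (f g : PS ν) : PS ν :=
  ∑ i : Fin ν,
    (MvPowerSeries.pderiv ℂ (Sum.inl i) f * MvPowerSeries.pderiv ℂ (Sum.inr i) g
      - MvPowerSeries.pderiv ℂ (Sum.inr i) f * MvPowerSeries.pderiv ℂ (Sum.inl i) g)

/-- The Hamiltonian vector field `X_f = ∑ (∂f/∂x_i ∂_{y_i} - ∂f/∂y_i ∂_{x_i})` as an operator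
on formal power series. -/
def hamField (f : PS ν) : Op ν := fun φ => poisson f φ

/-! ## Hamiltonians and the simplification procedure -/

/-- The quadratic part `∑ λ_i x_i y_i`. -/
def quadPart (lam : Fin ν → ℂ) : PS ν :=
  ∑ i : Fin ν, MvPowerSeries.C (lam i) * MvPowerSeries.X (Sum.inl i) * MvPowerSeries.X (Sum.inr i)

/-- `H = ∑ λ_i x_i y_i +` terms of total degree at least `3`. -/
def IsHamiltonian (lam : Fin ν → ℂ) (H : PS ν) : Prop :=
  ∀ d : Var ν →₀ ℕ, d.degree ≤ 2 → MvPowerSeries.coeff d H = MvPowerSeries.coeff d (quadPart lam)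

/-- The linear vector field `-∑ λ_i x_i ∂_{x_i} + ∑ λ_i y_i ∂_{y_i}`. -/
def linField (lam : Fin ν → ℂ) : Op ν := fun φ =>
  - ∑ i : Fin ν, MvPowerSeries.C (lam i) * MvPowerSeries.X (Sum.inl i)
      * MvPowerSeries.pderiv ℂ (Sum.inl i) φ
  + ∑ i : Fin ν, MvPowerSeries.C (lam i) * MvPowerSeries.X (Sum.inr i)
      * MvPowerSeries.pderiv ℂ (Sum.inr i) φ

/-- `ω(n, m) = ∑ λ_j (m_j - n_j)` for the monomial `xⁿ yᵐ`. -/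
def weight (lam : Fin ν → ℂ) (d : Var ν →₀ ℕ) : ℂ :=
  ∑ j : Fin ν, lam j * ((d (Sum.inr j) : ℂ) - (d (Sum.inl j) : ℂ))

/-- `A(H)`: the exponents of the higher-order monomials of `H`. -/
def higherExponents (H : PS ν) : Set (Var ν →₀ ℕ) :=
  {d | 3 ≤ d.degree ∧ MvPowerSeries.coeff d H ≠ 0}

/-- The alphabet `Ω(H) = {ω(n, m) : (n, m) ∈ A(H)}`. -/
def alphabet (lam : Fin ν → ℂ) (H : PS ν) : Set ℂ := weight lam '' higherExponents H

open Classical in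
/-- `H_ω`: the sum of the higher-order monomials of `H` with `ω(n, m) = ω`. -/
def component (lam : Fin ν → ℂ) (H : PS ν) (ω : ℂ) : PS ν :=
  fun d => if d ∈ higherExponents H ∧ weight lam d = ω then MvPowerSeries.coeff d H else 0

/-- The Hamiltonian operator `𝔇_ω = X_{H_ω}`. -/
def frakD (lam : Fin ν → ℂ) (H : PS ν) (ω : alphabet lam H) : Op ν :=
  hamField (component lam H (ω : ℂ))

/-- The value of a mould on complex letters at a word in the alphabet `Ω(H)`. -/
def onAlphabet {lam : Fin ν → ℂ} {H : PS ν} (M : Mould ℂ ℂ) : Mould (alphabet lam H) ℂ :=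
  fun w => M (w.map (fun ω => (ω : ℂ)))

/-- `X_lin + ∑ M^• 𝔇_•`, the sum over all words in the alphabet `Ω(H)`. -/
def mouldField (lam : Fin ν → ℂ) (H : PS ν) (M : Mould ℂ ℂ) : Op ν :=
  linField lam + formalSum (onAlphabet M) (wordOp (frakD lam H))

/-- `∑_{ω ∈ Ω(H), ω ≠ 0} (s / ω) 𝔇_ω`; used with `s = 1` and `s = -1`. -/
def generator (lam : Fin ν → ℂ) (H : PS ν) (s : ℂ) : Op ν :=
  formalSum (fun ω : {ω : alphabet lam H // (ω : ℂ) ≠ 0} => s / (ω.1 : ℂ))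
    (fun ω => frakD lam H ω.1)

/-- The transformation `exp (∑_{ω ≠ 0} (1/ω) 𝔇_ω)` of one simplification step. -/
def simp (lam : Fin ν → ℂ) (H : PS ν) : Op ν := expOp (generator lam H 1)

/-- `exp (∑_{ω ≠ 0} (-1/ω) 𝔇_ω)`. -/
def simpInv (lam : Fin ν → ℂ) (H : PS ν) : Op ν := expOp (generator lam H (-1))

/-- The simplified field
`exp (∑_{ω ≠ 0} (1/ω) 𝔇_ω) X_H exp (∑_{ω ≠ 0} (-1/ω) 𝔇_ω)`. -/
def simplified (lam : Fin ν → ℂ) (H : PS ν) : Op ν :=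
  simp lam H ∘ hamField H ∘ simpInv lam H

/-- `Hs 0 = H, Hs 1, Hs 2, …` are Hamiltonians with quadratic part `∑ λ_i x_i y_i` (and no
constant or linear term) whose vector fields are obtained from `X_H` by successive
simplifications. -/
def IsSimplificationSeq (lam : Fin ν → ℂ) (H : PS ν) (Hs : ℕ → PS ν) : Prop :=
  Hs 0 = H ∧ (∀ r, IsHamiltonian lam (Hs r)) ∧
    ∀ r, hamField (Hs (r + 1)) = simplified lam (Hs r)

/-- `X` is the trimmed form of `X_H`: the limit of the simplification procedure. -/
def IsTrimmedForm (lam : Fin ν → ℂ) (H : PS ν) (X : Op ν) : Prop :=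
  ∃ Hs : ℕ → PS ν, IsSimplificationSeq lam H Hs ∧ FormalLimit (fun r => hamField (Hs r)) X

/-- `Θ` is a formal canonical transformation: the substitution `φ ↦ φ ∘ h` of an invertible
change of variables `h` tangent to the identity, and it preserves Poisson brackets. -/
def IsCanonical (Θ : Op ν) : Prop :=
  (∃ h : Var ν → PS ν,
    (∀ s d, d.degree ≤ 1 →
      MvPowerSeries.coeff d (h s) = MvPowerSeries.coeff d (MvPowerSeries.X s : PS ν)) ∧
    ∀ φ, Θ φ = MvPowerSeries.subst h φ) ∧
  Function.Bijective Θ ∧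
  ∀ f g, Θ (poisson f g) = poisson (Θ f) (Θ g)

end HamMould

end

/-!
# The trimmed form of a formal Hamiltonian vector field

All identities between operators on `ℂ[[x, y]]` are checked modulo the series of order at least `N`,
for every `N`. A linear operator that does not lower the order (`filtOp`) acts on the jets
`ℂ[[x, y]] / (order ≥ N)` (`jet`), and is determined by these actions (`filtOp_ext`). On jets
only finitely many `𝔇_ω` are nonzero, and each raises the order, so only finitely many words `𝔇_w`
survive (`wordFinite_letterOp`). All the formal sums thereby become finite sums in a ring, where
`evalMould D M = ∑ M^w D_w` satisfies:

* mould products become products, and `Exp` becomes the exponential of a nilpotent element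
  (`evalMould_prod`, `evalMould_exp`);
* if `[L, D_a] = a D_a` for all letters then `[L, ∑ M^w D_w] = ∑ (∇M)^w D_w` (`evalMould_nabla`);
* `M ∘ N` at the letters `D_a` is `M` at the letters `∑_{‖w‖ = a} N^w D_w` (`evalMould_comp`).

Since `[X_lin, 𝔇_ω] = ω 𝔇_ω`, the first two give `X_lin + ∑ Sam^w 𝔇_w` for the simplified field
(`add_evalMould_sam`, `simplified_eq_mouldOp_sam`).

A Hamiltonian vector field with order-raising Hamiltonian acts by derivations both of the product
and of the Poisson bracket (Jacobi identity), so its exponential is an automorphism of both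
(`Raises.exp_bilin`), hence a canonical transformation `Θ`, a substitution by density of the
polynomials (`algHom_eq_subst`), and `Θ X_K Θ⁻¹ = X_{ΘK}`. In particular the simplified field is
again Hamiltonian, with Hamiltonian `ΘH`, unique because its constant term is `0`.

The operators `𝔇'_ω` of the simplified Hamiltonian are the parts of weight `ω` of
`∑ Sam^w 𝔇_w`: both families consist of eigenvectors of `[X_lin, ·]` and have the same sum
(`jet_letterOp_of_mouldOp`). Combined with `evalMould_comp`, iterated simplification is iterated
composition with `Sam` (`IsSimplificationSeq.hamField_eq`). Finally, `Sam ∘ ⋯ ∘ Sam` at `w` is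
stationary from the length of `w` on (`samIter_succ_eq`), because `Sam` vanishes on nonzero letters
and is the identity mould on words of zeros; so modulo each order the fields are stationary, and the
limit is read off.
-/

noncomputable section
namespace HamMould

/-! ### Finite sums over fibres -/

theorem finsum_fiberwise {α β G : Type*} [AddCommMonoid G] (f : α → β) (g : α → G)
    (hg : g.support.Finite) :
    ∑ᶠ b, ∑ᶠ (a) (_ : f a = b), g a = ∑ᶠ a, g a := by
  classical
  have h1 : ∀ b, ∑ᶠ (a) (_ : f a = b), g a = ∑ a ∈ hg.toFinset with f a = b, g a := by
    intro b
    refine finsum_cond_eq_sum_of_cond_iff g fun {a} ha => ?_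
    simp [Function.mem_support.1 ha]
  simp_rw [h1]
  rw [finsum_eq_sum_of_support_subset (s := hg.toFinset.image f),
    finsum_eq_sum_of_support_subset (f := g) (s := hg.toFinset) (by simp)]
  · exact Finset.sum_fiberwise_of_maps_to (fun a ha => Finset.mem_image_of_mem f ha) g
  · intro b hb
    obtain ⟨a, ha, -⟩ := Finset.exists_ne_zero_of_sum_ne_zero hb
    rw [Finset.mem_filter] at ha
    rw [← ha.2]
    exact Finset.mem_coe.2 (Finset.mem_image_of_mem f ha.1)

/-- A sum over a subtype whose nonzero terms are enumerated without repetition by a finite set. -/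
theorem finsum_cond_eq_sum {α ι G : Type*} [AddCommMonoid G] {P : α → Prop} (g : α → G)
    (s : Finset ι) (e : ι → α) (he : Set.InjOn e s) (hP : ∀ i ∈ s, P (e i))
    (hs : ∀ a, P a → g a ≠ 0 → ∃ i ∈ s, e i = a) :
    ∑ᶠ (a) (_ : P a), g a = ∑ i ∈ s, g (e i) := by
  classical
  rw [← Finset.sum_image he]
  refine finsum_cond_eq_sum_of_cond_iff g ?_
  intro a ha
  rw [Finset.mem_image]
  constructor
  · exact fun h => hs a h ha
  · rintro ⟨i, hi, rfl⟩
    exact hP i hi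

/-! ### Evaluating moulds at families of ring elements -/

section Evaluation

variable {A B R : Type*} [Ring R]

/-- Only finitely many words in the elements `D a` have a nonzero product. -/
def WordFinite (D : A → R) : Prop := {w : List A | (w.map D).prod ≠ 0}.Finite

/-- `∑ M^w D_w`, where `D_w` is the product of the `D a` along the word `w`. -/
def evalMould [Algebra ℂ R] (D : A → R) (M : Mould A ℂ) : R := ∑ᶠ w, M w • (w.map D).prod

theorem WordFinite.support {D : A → R} (hD : WordFinite D) : D.support.Finite := by
  refine Set.Finite.of_injOn (f := fun a => [a]) (t := {w : List A | (w.map D).prod ≠ 0})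
    (fun a ha => by simpa using ha) (fun a _ b _ h => by simpa using h) hD

/-- A family with finitely many nonzero members, all of whose long enough words vanish. -/
theorem WordFinite.of_length {D : A → R} (hD : D.support.Finite) (K : ℕ)
    (hK : ∀ w : List A, K ≤ w.length → (w.map D).prod = 0) : WordFinite D := by
  have : Finite D.support := hD
  refine ((List.finite_length_lt D.support K).image (List.map Subtype.val)).subset ?_
  intro w hw
  have hmem : ∀ a ∈ w, D a ≠ 0 := by
    intro a ha h0
    exact hw (List.prod_eq_zero (by rw [List.mem_map]; exact ⟨a, ha, h0⟩))
  refine ⟨w.attach.map (fun a => ⟨a.1, hmem a.1 a.2⟩), ?_, ?_⟩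
  · simp only [Set.mem_ofPred_eq, List.length_map, List.length_attach]
    by_contra h
    exact hw (hK w (not_lt.1 h))
  · simp [List.map_map, Function.comp_def]

theorem WordFinite.exists_length {D : A → R} (hD : WordFinite D) :
    ∃ K, ∀ w : List A, K ≤ w.length → (w.map D).prod = 0 := by
  obtain ⟨K, hK⟩ := (hD.image List.length).bddAbove
  refine ⟨K + 1, fun w hw => ?_⟩
  by_contra h
  have := hK ⟨w, h, rfl⟩
  omega

/-- The finite set of words with a nonzero product. -/
def WordFinite.words {D : A → R} (hD : WordFinite D) : Finset (List A) :=
  Set.Finite.toFinset (s := {w : List A | (w.map D).prod ≠ 0}) hD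

theorem WordFinite.mem_words {D : A → R} (hD : WordFinite D) {w : List A} :
    w ∈ hD.words ↔ (w.map D).prod ≠ 0 :=
  Set.Finite.mem_toFinset (s := {w : List A | (w.map D).prod ≠ 0}) hD

/-- A word in the sums `∑_{p b = a} g b` expands into the words in the `g b` above it. -/
theorem prod_map_pushforward {g : B → R} (hg : WordFinite g) (p : B → A) (u : List A) :
    (u.map fun a => ∑ᶠ (b) (_ : p b = a), g b).prod =
      ∑ᶠ (v : List B) (_ : v.map p = u), (v.map g).prod := by
  classical
  induction u with
  | nil =>
    rw [finsum_cond_eq_sum _ {([] : List B)} id] <;> simp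
  | cons a u ih =>
    rw [List.map_cons, List.prod_cons, ih]
    have h1 : ∀ (b : B), (∑ᶠ (_ : p b = a), g b) = if p b = a then g b else 0 := fun b =>
      finsum_eq_if
    have h2 : ∀ (v : List B), (∑ᶠ (_ : v.map p = u), (v.map g).prod) =
        if v.map p = u then (v.map g).prod else 0 := fun b => finsum_eq_if
    have h3 : ∀ (v : List B), (∑ᶠ (_ : v.map p = a :: u), (v.map g).prod) =
        if v.map p = a :: u then (v.map g).prod else 0 := fun b => finsum_eq_if
    simp_rw [h1, h2, h3]
    set f1 : B → R := fun b => if p b = a then g b else 0 with hf1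
    set f2 : List B → R := fun v => if v.map p = u then (v.map g).prod else 0 with hf2
    have hs1 : f1.support.Finite := hg.support.subset fun b hb h => hb (by simp [hf1, h])
    have hs2 : f2.support.Finite := hg.subset fun b hb h => hb (by simp [hf2, h])
    set G : List B → R := fun v => if v.map p = a :: u then (v.map g).prod else 0 with hG
    have hfin : (Function.support fun q : B × List B => f1 q.1 * f2 q.2).Finite := by
      refine (hs1.prod hs2).subset ?_
      rintro ⟨b, v⟩ h
      exact ⟨fun h0 => h (by simp only [h0, zero_mul]), fun h0 => h (by simp only [h0, mul_zero])⟩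
    have hL : (∑ᶠ b, f1 b) * ∑ᶠ v, f2 v = ∑ᶠ q : B × List B, f1 q.1 * f2 q.2 := by
      rw [finsum_curry _ hfin, finsum_mul' _ _ hs1]
      refine finsum_congr fun b => ?_
      rw [mul_finsum' _ _ hs2]
    have hinj : Function.Injective fun q : B × List B => q.1 :: q.2 := by
      rintro ⟨b, v⟩ ⟨b', v'⟩ h
      simpa using h
    rw [hL, ← finsum_mem_univ (f := G),
      ← finsum_mem_inter_support_eq' _ (Set.range fun q : B × List B => q.1 :: q.2),
      finsum_mem_range hinj]
    · refine finsum_congr fun q => ?_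
      simp only [hf1, hf2, hG, List.map_cons, List.cons.injEq, List.prod_cons]
      by_cases ha : p q.1 = a <;> by_cases hu : q.2.map p = u <;> simp [ha, hu]
    · intro v hv
      cases v with
      | nil => simp [hG] at hv
      | cons b v => simp

variable [Algebra ℂ R]

theorem WordFinite.smul_support {D : A → R} (hD : WordFinite D) (M : Mould A ℂ) :
    (Function.support fun w => M w • (w.map D).prod).Finite :=
  hD.subset fun w hw h => hw (by simp only [h, smul_zero])

theorem evalMould_eq_sum {D : A → R} (hD : WordFinite D) (M : Mould A ℂ) :
    evalMould D M = ∑ w ∈ hD.words, M w • (w.map D).prod :=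
  finsum_eq_sum_of_support_subset _ fun w hw => by
    rw [Finset.mem_coe, hD.mem_words]
    exact fun h => hw (by simp only [h, smul_zero])

theorem evalMould_add {D : A → R} (hD : WordFinite D) (M N : Mould A ℂ) :
    evalMould D (M + N) = evalMould D M + evalMould D N := by
  simp only [evalMould_eq_sum hD, Pi.add_apply, add_smul, Finset.sum_add_distrib]

theorem evalMould_smul {D : A → R} (hD : WordFinite D) (c : ℂ) (M : Mould A ℂ) :
    evalMould D (c • M) = c • evalMould D M := by
  simp only [evalMould_eq_sum hD, Pi.smul_apply, smul_assoc, Finset.smul_sum]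

theorem evalMould_neg {D : A → R} (hD : WordFinite D) (M : Mould A ℂ) :
    evalMould D (-M) = -evalMould D M := by
  rw [← neg_one_smul ℂ M, evalMould_smul hD, neg_one_smul]

theorem evalMould_sub {D : A → R} (hD : WordFinite D) (M N : Mould A ℂ) :
    evalMould D (M - N) = evalMould D M - evalMould D N := by
  rw [sub_eq_add_neg, evalMould_add hD, evalMould_neg hD, sub_eq_add_neg]

theorem evalMould_one (D : A → R) : evalMould D Mould.one = 1 := by
  rw [evalMould, finsum_eq_single _ []]
  · simp [Mould.one]
  · intro w hw
    cases w with
    | nil => exact absurd rfl hw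
    | cons a w => simp [Mould.one]

/-- A mould carried by the one-letter words evaluates to a linear combination of the letters. -/
theorem evalMould_of_letters (D : A → R) (M : Mould A ℂ) (hM : ∀ w, w.length ≠ 1 → M w = 0) :
    evalMould D M = ∑ᶠ a, M [a] • D a := by
  have hsub : (Function.support fun w => M w • (w.map D).prod) ⊆ Set.range fun a : A => [a] := by
    intro w hw
    by_contra h
    refine hw ?_
    simp only
    rw [hM w, zero_smul]
    intro h1
    obtain ⟨a, rfl⟩ := List.length_eq_one_iff.1 h1
    exact h ⟨a, rfl⟩
  rw [evalMould, ← finsum_mem_univ, ← finsum_mem_inter_support_eq' _ (Set.range fun a : A => [a]),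
    finsum_mem_range]
  · simp
  · intro a b h
    simpa using h
  · intro w hw
    simp [hsub hw]

/-- Evaluation turns the mould product into the product of the ring. -/
theorem evalMould_prod {D : A → R} (hD : WordFinite D) (M N : Mould A ℂ) :
    evalMould D (M.prod N) = evalMould D M * evalMould D N := by
  classical
  set g : List A × List A → R :=
    fun p => (M p.1 • (p.1.map D).prod) * (N p.2 • (p.2.map D).prod) with hg
  have hfin : g.support.Finite := by
    refine (hD.prod hD).subset ?_
    rintro ⟨u, v⟩ h
    constructor
    · intro h0
      exact h (by simp only [hg, h0, smul_zero, zero_mul])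
    · intro h0
      exact h (by simp only [hg, h0, smul_zero, mul_zero])
  have h1 : evalMould D M * evalMould D N = ∑ᶠ p, g p := by
    rw [finsum_curry _ hfin, evalMould, finsum_mul' _ _ (hD.smul_support M)]
    refine finsum_congr fun u => ?_
    rw [evalMould, mul_finsum' _ _ (hD.smul_support N)]
  rw [h1, ← finsum_fiberwise (fun p : List A × List A => p.1 ++ p.2) g hfin, evalMould]
  refine finsum_congr fun w => ?_
  rw [finsum_cond_eq_sum g (Finset.range (w.length + 1)) (fun k => (w.take k, w.drop k)),
    Mould.prod, Finset.sum_smul]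
  · refine Finset.sum_congr rfl fun k _ => ?_
    simp only [hg]
    rw [smul_mul_smul_comm, ← List.prod_append, ← List.map_append, List.take_append_drop]
  · intro k hk l hl h
    have := congrArg List.length (Prod.ext_iff.1 h).1
    simp at this hk hl
    omega
  · simp
  · rintro ⟨u, v⟩ h -
    refine ⟨u.length, ?_, ?_⟩
    · simp [← h]
    · simp [← h]

/-! ### Exponentials -/

/-- The exponential `∑ aⁿ / n!` of an element of a `ℂ`-algebra; it has its usual meaning when `a`
is nilpotent. -/
def nilExp (a : R) : R := ∑ᶠ n : ℕ, (1 / (n.factorial : ℂ)) • a ^ n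

theorem nilExp_eq_sum {a : R} {k : ℕ} (h : a ^ k = 0) :
    nilExp a = ∑ n ∈ Finset.range k, (1 / (n.factorial : ℂ)) • a ^ n := by
  unfold nilExp
  refine finsum_eq_sum_of_support_subset _ fun n hn => ?_
  by_contra hk
  refine hn ?_
  simp only [Finset.coe_range, Set.mem_Iio, not_lt] at hk
  simp only [pow_eq_zero_of_le hk h, smul_zero]

theorem nilExp_mul_neg {a : R} (ha : IsNilpotent a) : nilExp a * nilExp (-a) = 1 := by
  let _ : Module ℚ R := Module.compHom R (algebraMap ℚ ℂ)
  have key : ∀ b : R, IsNilpotent b → nilExp b = IsNilpotent.exp b := by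
    rintro b ⟨k, hk⟩
    rw [nilExp_eq_sum hk, IsNilpotent.exp_eq_sum hk]
    refine Finset.sum_congr rfl fun n _ => ?_
    change _ = (algebraMap ℚ ℂ (n.factorial : ℚ)⁻¹) • b ^ n
    simp
  rw [key a ha, key _ ha.neg]
  exact IsNilpotent.exp_mul_exp_neg_self ha

theorem Mould.npow_eq_zero {M : Mould A ℂ} (hM : M [] = 0) (n : ℕ) :
    ∀ w : List A, w.length < n → M.npow n w = 0 := by
  induction n with
  | zero => simp
  | succ n ih =>
    intro w hw
    unfold Mould.npow Mould.prod
    refine Finset.sum_eq_zero fun k hk => ?_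
    rw [Finset.mem_range] at hk
    by_cases h : k < n
    · rw [ih, zero_mul]
      simp
      omega
    · have : w.drop k = [] := by
        rw [List.drop_eq_nil_iff]
        omega
      rw [this, hM, mul_zero]

theorem evalMould_npow {D : A → R} (hD : WordFinite D) (M : Mould A ℂ) (n : ℕ) :
    evalMould D (M.npow n) = evalMould D M ^ n := by
  induction n with
  | zero => rw [pow_zero, Mould.npow, evalMould_one]
  | succ n ih => rw [Mould.npow, evalMould_prod hD, ih, pow_succ]

theorem evalMould_pow_eq_zero {D : A → R} (hD : WordFinite D) {M : Mould A ℂ} (hM : M [] = 0)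
    {K : ℕ} (hK : ∀ w : List A, K ≤ w.length → (w.map D).prod = 0) :
    evalMould D M ^ K = 0 := by
  rw [← evalMould_npow hD, evalMould]
  refine finsum_eq_zero_of_forall_eq_zero fun w => ?_
  rcases lt_or_ge w.length K with h | h
  · rw [M.npow_eq_zero hM K w h, zero_smul]
  · rw [hK w h, smul_zero]

theorem isNilpotent_evalMould {D : A → R} (hD : WordFinite D) {M : Mould A ℂ} (hM : M [] = 0) :
    IsNilpotent (evalMould D M) := by
  obtain ⟨K, hK⟩ := hD.exists_length
  exact ⟨K, evalMould_pow_eq_zero hD hM hK⟩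

theorem evalMould_exp {D : A → R} (hD : WordFinite D) {M : Mould A ℂ} (hM : M [] = 0) :
    evalMould D M.exp = nilExp (evalMould D M) := by
  obtain ⟨K, hK⟩ := hD.exists_length
  rw [nilExp_eq_sum (evalMould_pow_eq_zero hD hM hK)]
  simp_rw [← evalMould_npow hD, evalMould_eq_sum hD, Finset.smul_sum]
  rw [Finset.sum_comm]
  refine Finset.sum_congr rfl fun w hw => ?_
  have hlen : w.length + 1 ≤ K := by
    by_contra h
    exact hD.mem_words.1 hw (hK w (by omega))
  simp_rw [← smul_assoc]
  rw [← Finset.sum_smul, Mould.exp]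
  congr 1
  rw [Finset.sum_subset (Finset.range_subset_range.2 hlen)]
  · refine Finset.sum_congr rfl fun n _ => ?_
    rw [smul_eq_mul, div_eq_inv_mul, one_div]
  · intro n _ hn
    rw [M.npow_eq_zero hM n w (by simp at hn; omega), zero_div]

/-! ### Composition -/

theorem evalMould_pushforward {g : B → R} (hg : WordFinite g) (p : B → A) (M : Mould A ℂ) :
    evalMould (fun a => ∑ᶠ (b) (_ : p b = a), g b) M =
      evalMould g fun v => M (v.map p) := by
  classical
  rw [evalMould, evalMould, ← finsum_fiberwise (List.map p) _ (hg.smul_support _)]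
  refine finsum_congr fun u => ?_
  rw [prod_map_pushforward hg, smul_finsum']
  · refine finsum_congr fun v => ?_
    by_cases h : v.map p = u <;> simp [h]
  · refine hg.subset fun v hv h => hv ?_
    simp [h]

theorem prod_map_block (D : A → R) (N : Mould A ℂ) (ws : List (List A)) :
    (ws.map fun w => N w • (w.map D).prod).prod =
      (ws.map N).prod • (ws.flatten.map D).prod := by
  induction ws with
  | nil => simp
  | cons w ws ih =>
    simp only [List.map_cons, List.prod_cons, ih, List.flatten_cons, List.map_append,
      List.prod_append, smul_mul_smul_comm]

theorem exists_splitWrtComposition_eq {ws : List (List A)} (h : ∀ w ∈ ws, w ≠ []) :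
    ∃ c : Composition ws.flatten.length, ws.flatten.splitWrtComposition c = ws := by
  refine ⟨⟨ws.map List.length, ?_, ?_⟩, ?_⟩
  · intro i hi
    obtain ⟨w, hw, rfl⟩ := List.mem_map.1 hi
    exact List.length_pos_iff.2 (h w hw)
  · simp [List.length_flatten]
  · exact List.splitWrtComposition_flatten _ _ rfl

theorem WordFinite.blocks {D : A → R} (hD : WordFinite D) {N : Mould A ℂ} (hN : N [] = 0) :
    WordFinite fun w => N w • (w.map D).prod := by
  refine (hD.biUnion fun w _ => Set.finite_range fun c : Composition w.length =>
    w.splitWrtComposition c).subset ?_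
  intro ws hws
  rw [Set.mem_ofPred_eq, prod_map_block] at hws
  have hne : ∀ w ∈ ws, w ≠ [] := by
    rintro w hw rfl
    refine hws ?_
    rw [List.prod_eq_zero (by rw [List.mem_map]; exact ⟨[], hw, hN⟩), zero_smul]
  obtain ⟨c, hc⟩ := exists_splitWrtComposition_eq hne
  simp only [Set.mem_iUnion]
  exact ⟨ws.flatten, fun h => hws (by rw [h, smul_zero]), c, hc⟩

/-- Composition of moulds is substitution of letters: evaluating `M ∘ N` at the `D a` is evaluating
`M` at the elements `∑_{‖w‖ = a} N^w D_w`. -/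
theorem evalMould_comp [AddMonoid A] {D : A → R} (hD : WordFinite D) (M : Mould A ℂ)
    {N : Mould A ℂ} (hN : N [] = 0) :
    evalMould D (M.comp N) =
      evalMould (fun a => ∑ᶠ (w : List A) (_ : w.sum = a), N w • (w.map D).prod) M := by
  classical
  have hB := hD.blocks hN
  rw [evalMould_pushforward hB, evalMould, evalMould,
    ← finsum_fiberwise List.flatten _ (hB.smul_support _)]
  refine finsum_congr fun w => ?_
  rw [finsum_cond_eq_sum _ Finset.univ fun c : Composition w.length => w.splitWrtComposition c,
    Mould.comp, Finset.sum_smul]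
  · refine Finset.sum_congr rfl fun c _ => ?_
    rw [prod_map_block, List.flatten_splitWrtComposition, smul_smul]
  · intro c _ c' _ h
    have h' := congrArg (List.map List.length) h
    simp only [List.map_length_splitWrtComposition] at h'
    exact Composition.ext h'
  · simp
  · rintro ws rfl h
    have hne : ∀ w ∈ ws, w ≠ [] := by
      rintro w hw rfl
      refine h ?_
      rw [prod_map_block, List.prod_eq_zero (by rw [List.mem_map]; exact ⟨[], hw, hN⟩), zero_smul,
        smul_zero]
    obtain ⟨c, hc⟩ := exists_splitWrtComposition_eq hne
    exact ⟨c, Finset.mem_univ _, hc⟩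

/-! ### Letters that are eigenvectors of a commutator -/

theorem commutator_word {D : ℂ → R} {L : R} (hL : ∀ a, L * D a - D a * L = a • D a)
    (w : List ℂ) :
    L * (w.map D).prod - (w.map D).prod * L = w.sum • (w.map D).prod := by
  induction w with
  | nil => simp
  | cons a w ih =>
    rw [List.map_cons, List.prod_cons, List.sum_cons, add_smul]
    calc L * (D a * (w.map D).prod) - D a * (w.map D).prod * L
        = (L * D a - D a * L) * (w.map D).prod
          + D a * (L * (w.map D).prod - (w.map D).prod * L) := by noncomm_ring
      _ = _ := by rw [hL, ih, smul_mul_assoc, mul_smul_comm]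

theorem evalMould_nabla {D : ℂ → R} (hD : WordFinite D) {L : R}
    (hL : ∀ a, L * D a - D a * L = a • D a) (M : Mould ℂ ℂ) :
    evalMould D M.nabla = L * evalMould D M - evalMould D M * L := by
  simp only [evalMould_eq_sum hD, Finset.mul_sum, Finset.sum_mul, ← Finset.sum_sub_distrib]
  refine Finset.sum_congr rfl fun w _ => ?_
  rw [mul_smul_comm, smul_mul_assoc, ← smul_sub, commutator_word hL, smul_smul, Mould.nabla,
    mul_comm]

theorem vMould_eq_zero_of_length : ∀ w : List ℂ, w.length ≠ 1 → vMould w = 0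
  | [], _ => rfl
  | [_], h => absurd rfl h
  | _ :: _ :: _, _ => rfl

theorem ident_eq_zero_of_length : ∀ w : List A, w.length ≠ 1 → (Mould.ident w : ℂ) = 0
  | [], _ => rfl
  | [_], h => absurd rfl h
  | _ :: _ :: _, _ => rfl

/-- The mould `Sam` computes the conjugation of `L + ∑ D a` by the exponential of
`∑_{a ≠ 0} D a / a`. -/
theorem add_evalMould_sam {D : ℂ → R} (hD : WordFinite D) {L : R}
    (hL : ∀ a, L * D a - D a * L = a • D a) :
    L + evalMould D sam =
      nilExp (evalMould D vMould) * (L + evalMould D Mould.ident)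
        * nilExp (-evalMould D vMould) := by
  have h0 : (-vMould) [] = 0 := by simp [vMould]
  rw [sam, evalMould_sub hD, evalMould_prod hD, evalMould_prod hD, evalMould_prod hD,
    evalMould_nabla hD hL, evalMould_exp hD rfl, evalMould_exp hD h0, evalMould_neg hD]
  have h1 := nilExp_mul_neg (isNilpotent_evalMould hD (M := vMould) rfl)
  calc _ = L + nilExp (evalMould D vMould) * (evalMould D Mould.ident + L)
              * nilExp (-evalMould D vMould)
            - L * (nilExp (evalMould D vMould) * nilExp (-evalMould D vMould)) := by noncomm_ring
    _ = _ := by rw [h1, add_comm (evalMould D Mould.ident)]; noncomm_ring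

end Evaluation

/-! ### The iterated compositions of `Sam` are stationary -/

section Stationary

variable {A : Type*}

theorem Mould.one_of_ne_nil {w : List A} (hw : w ≠ []) : (Mould.one w : ℂ) = 0 := by
  cases w with
  | nil => exact absurd rfl hw
  | cons a w => rfl

theorem Mould.one_prod (M : Mould A ℂ) : Mould.one.prod M = M := by
  funext w
  rw [Mould.prod, Finset.sum_eq_single 0]
  · simp [Mould.one]
  · intro k hk h0
    rw [Mould.one_of_ne_nil, zero_mul]
    intro h
    rw [List.take_eq_nil_iff] at h
    rcases h with h | rfl
    · exact h0 h
    · simp at hk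
      exact h0 hk
  · simp

theorem Mould.prod_one (M : Mould A ℂ) : M.prod Mould.one = M := by
  funext w
  rw [Mould.prod, Finset.sum_eq_single w.length]
  · simp [Mould.one]
  · intro k hk h0
    rw [Mould.one_of_ne_nil, mul_zero]
    intro h
    rw [List.drop_eq_nil_iff] at h
    rw [Finset.mem_range] at hk
    omega
  · simp

/-- The product at `w` only depends on the values at words with letters from `w`. -/
theorem Mould.prod_congr {S : Set A} {M M' N N' : Mould A ℂ}
    (hM : ∀ w, (∀ a ∈ w, a ∈ S) → M w = M' w) (hN : ∀ w, (∀ a ∈ w, a ∈ S) → N w = N' w) :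
    ∀ w, (∀ a ∈ w, a ∈ S) → M.prod N w = M'.prod N' w := fun w hw =>
  Finset.sum_congr rfl fun k _ => by
    rw [hM _ fun a ha => hw a (List.mem_of_mem_take ha),
      hN _ fun a ha => hw a (List.mem_of_mem_drop ha)]

theorem Mould.exp_eq_one {S : Set A} {M : Mould A ℂ} (hM : ∀ w, (∀ a ∈ w, a ∈ S) → M w = 0) :
    ∀ w, (∀ a ∈ w, a ∈ S) → M.exp w = Mould.one w := by
  intro w hw
  rw [Mould.exp, Finset.sum_eq_single 0]
  · simp [Mould.npow]
  · intro n _ hn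
    obtain ⟨n, rfl⟩ := Nat.exists_eq_succ_of_ne_zero hn
    rw [Mould.npow, Mould.prod, Finset.sum_eq_zero, zero_div]
    intro k _
    rw [hM _ fun a ha => hw a (List.mem_of_mem_drop ha), mul_zero]
  · simp

theorem vMould_zeros : ∀ w : List ℂ, (∀ a ∈ w, a ∈ ({0} : Set ℂ)) → vMould w = 0
  | [], _ => rfl
  | [a], h => by
    have : a = 0 := h a (by simp)
    simp [vMould, this]
  | _ :: _ :: _, _ => rfl

theorem sam_zeros {w : List ℂ} (hw : ∀ a ∈ w, a ∈ ({0} : Set ℂ)) : sam w = Mould.ident w := by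
  have h1 := Mould.exp_eq_one vMould_zeros
  have h2 : ∀ w, (∀ a ∈ w, a ∈ ({0} : Set ℂ)) → (-vMould).exp w = Mould.one w :=
    Mould.exp_eq_one fun w hw => by rw [Pi.neg_apply, vMould_zeros w hw, neg_zero]
  have h3 : ∀ w, (∀ a ∈ w, a ∈ ({0} : Set ℂ)) → vMould.exp.nabla w = (0 : Mould ℂ ℂ) w :=
    fun w hw => by
      rw [Mould.nabla, List.sum_eq_zero fun a ha => hw a ha, zero_mul, Pi.zero_apply]
  have h4 := Mould.prod_congr (Mould.prod_congr h1 fun w _ => (rfl : Mould.ident w = _)) h2 w hw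
  have h5 := Mould.prod_congr h3 h2 w hw
  rw [sam, Pi.sub_apply, h4, h5, Mould.prod_one, Mould.one_prod, Mould.prod_one, Pi.zero_apply,
    sub_zero]

theorem sam_nil : sam [] = 0 := by
  rw [sam_zeros (by simp)]
  rfl

theorem sam_singleton {a : ℂ} (ha : a ≠ 0) : sam [a] = 0 := by
  simp [sam, Mould.prod, Mould.exp, Mould.nabla, Mould.npow, Mould.one, Mould.ident, vMould,
    Finset.sum_range_succ, ha]

theorem splitWrtComposition_ones (w : List A) :
    w.splitWrtComposition (Composition.ones w.length) = w.map fun a => [a] := by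
  rw [List.eq_iff_flatten_eq]
  constructor
  · rw [List.flatten_splitWrtComposition]
    induction w with
    | nil => rfl
    | cons a w ih => simp [← ih]
  · rw [List.map_length_splitWrtComposition]
    simp only [Composition.ones, List.map_map, Function.comp_def, List.length_singleton,
      List.map_const']

/-- The part of `samIter (p + 1) w` that involves proper contractions of `w` depends on `samIter p`
at shorter words only; the uncontracted term vanishes as soon as `w` has a nonzero letter, and it is
the only one when all letters vanish. -/
theorem samIter_succ_eq (w : List ℂ) : ∀ p, w.length ≤ p → samIter (p + 1) w = samIter p w := by
  induction h : w.length using Nat.strong_induction_on generalizing w with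
  | _ n ih =>
  subst h
  intro p hp
  by_cases hw : ∀ a ∈ w, a ∈ ({0} : Set ℂ)
  · rw [samIter, Mould.comp, Finset.sum_eq_single (Composition.ones w.length)]
    · rw [splitWrtComposition_ones]
      have h1 : ((w.map fun a => [a]).map sam).prod = 1 := by
        refine List.prod_eq_one fun x hx => ?_
        rw [List.map_map, List.mem_map] at hx
        obtain ⟨a, ha, rfl⟩ := hx
        rw [Function.comp_apply, sam_zeros (by simpa using hw a ha)]
        rfl
      rw [h1, mul_one, List.map_map]
      congr 1
      refine List.map_id'' (fun a => ?_) w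
      simp
    · intro c _ hc
      rw [Composition.ne_ones_iff] at hc
      obtain ⟨i, hi, h1⟩ := hc
      rw [← List.map_length_splitWrtComposition, List.mem_map] at hi
      obtain ⟨u, hu, rfl⟩ := hi
      have hus : sam u = 0 := by
        rw [sam_zeros fun a ha => hw a ?_, ident_eq_zero_of_length u h1.ne']
        rw [← List.flatten_splitWrtComposition w c]
        exact List.mem_flatten.2 ⟨u, hu, ha⟩
      rw [List.prod_eq_zero (List.mem_map.2 ⟨u, hu, hus⟩), mul_zero]
    · simp
  · push Not at hw
    obtain ⟨a, ha, ha0⟩ := hw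
    obtain ⟨q, rfl⟩ : ∃ q, p = q + 1 := Nat.exists_eq_succ_of_ne_zero (by
      have := List.length_pos_of_mem ha
      omega)
    rw [samIter, samIter, Mould.comp, Mould.comp]
    refine Finset.sum_congr rfl fun c _ => ?_
    by_cases hc : c = Composition.ones w.length
    · have h0 : ((w.splitWrtComposition c).map sam).prod = 0 := by
        rw [hc, splitWrtComposition_ones]
        refine List.prod_eq_zero (List.mem_map.2 ⟨[a], ?_, sam_singleton ha0⟩)
        exact List.mem_map.2 ⟨a, ha, rfl⟩
      rw [h0, mul_zero, mul_zero]
    · have hlt : ((w.splitWrtComposition c).map List.sum).length < w.length := by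
        rw [List.length_map, List.length_splitWrtComposition]
        exact lt_of_le_of_ne c.length_le fun h => hc (Composition.eq_ones_iff_length.2 h)
      have hs := ih _ hlt _ rfl q (by omega)
      rw [samIter] at hs
      rw [hs]

theorem samIter_eq_tram (w : List ℂ) (p : ℕ) (hp : w.length ≤ p) : samIter p w = tram w := by
  induction p, hp using Nat.le_induction with
  | base => rfl
  | succ p hp ih => rw [samIter_succ_eq w p hp, ih]

end Stationary

open MvPowerSeries

/-! ### The filtration by order and filtered operators -/

section Filtration

variable {ν : ℕ}

/-- The series all of whose monomials have total degree at least `n`. -/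
def ordGE (ν n : ℕ) : Submodule ℂ (PS ν) where
  carrier := {φ | ∀ d : Var ν →₀ ℕ, d.degree < n → coeff d φ = 0}
  zero_mem' := fun d _ => map_zero _
  add_mem' := fun hf hg d hd => by rw [map_add, hf d hd, hg d hd, add_zero]
  smul_mem' := fun c f hf d hd => by rw [map_smul, hf d hd, smul_zero]

theorem mem_ordGE {n : ℕ} {φ : PS ν} :
    φ ∈ ordGE ν n ↔ ∀ d : Var ν →₀ ℕ, d.degree < n → coeff d φ = 0 := Iff.rfl

theorem mem_ordGE_iff_order {n : ℕ} {φ : PS ν} : φ ∈ ordGE ν n ↔ (n : ℕ∞) ≤ φ.order :=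
  ⟨fun h => nat_le_order h, fun h _ hd =>
    coeff_of_lt_order (lt_of_lt_of_le (by exact_mod_cast hd) h)⟩

theorem ordGE_anti {m n : ℕ} (h : m ≤ n) : ordGE ν n ≤ ordGE ν m :=
  fun _ hφ d hd => hφ d (lt_of_lt_of_le hd h)

theorem mem_ordGE_zero (φ : PS ν) : φ ∈ ordGE ν 0 := fun _ hd => absurd hd (Nat.not_lt_zero _)

theorem mul_mem_ordGE {m n : ℕ} {f g : PS ν} (hf : f ∈ ordGE ν m) (hg : g ∈ ordGE ν n) :
    f * g ∈ ordGE ν (m + n) := by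
  rw [mem_ordGE_iff_order] at *
  push_cast
  exact (add_le_add hf hg).trans le_order_mul

theorem eq_zero_of_forall_mem_ordGE {f : PS ν} (h : ∀ n, f ∈ ordGE ν n) : f = 0 := by
  ext d
  exact h (d.degree + 1) d (Nat.lt_succ_self _)

theorem eq_of_forall_sub_mem_ordGE {f g : PS ν} (h : ∀ n, f - g ∈ ordGE ν n) : f = g :=
  sub_eq_zero.1 (eq_zero_of_forall_mem_ordGE h)

theorem pderiv_mem_ordGE {n : ℕ} {f : PS ν} (hf : f ∈ ordGE ν n) (s : Var ν) :
    MvPowerSeries.pderiv ℂ s f ∈ ordGE ν (n - 1) := by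
  intro d hd
  rw [coeff_pderiv, hf, zero_mul]
  rw [map_add, Finsupp.degree_single]
  omega

/-- The linear operators on `ℂ[[x, y]]` that do not lower the order. -/
def filtOp (ν : ℕ) : Subalgebra ℂ (Module.End ℂ (PS ν)) where
  carrier := {T | ∀ n, ∀ φ ∈ ordGE ν n, T φ ∈ ordGE ν n}
  mul_mem' := fun hS hT n φ hφ => hS n _ (hT n φ hφ)
  add_mem' := fun hS hT n φ hφ => Submodule.add_mem _ (hS n φ hφ) (hT n φ hφ)
  algebraMap_mem' := fun c n φ hφ => by
    rw [Module.algebraMap_end_apply]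
    exact Submodule.smul_mem _ _ hφ

/-- The action of a filtered operator on `ℂ[[x, y]]` modulo the series of order at least `N`. -/
def jet (ν N : ℕ) : filtOp ν →ₐ[ℂ] Module.End ℂ (PS ν ⧸ ordGE ν N) where
  toFun T := (ordGE ν N).mapQ (ordGE ν N) T.1 (fun φ hφ => T.2 N φ hφ)
  map_one' := by ext; rfl
  map_mul' S T := by ext; rfl
  map_zero' := by ext; rfl
  map_add' S T := by ext; rfl
  commutes' c := by ext; rfl

theorem jet_mk (N : ℕ) (T : filtOp ν) (φ : PS ν) :
    jet ν N T (Submodule.Quotient.mk φ) = Submodule.Quotient.mk (T.1 φ) := rfl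

theorem jet_eq_iff {N : ℕ} {S T : filtOp ν} :
    jet ν N S = jet ν N T ↔ ∀ φ, S.1 φ - T.1 φ ∈ ordGE ν N := by
  constructor
  · intro h φ
    rw [← Submodule.Quotient.eq, ← jet_mk, ← jet_mk, h]
  · intro h
    refine LinearMap.ext fun q => ?_
    obtain ⟨φ, rfl⟩ := Submodule.Quotient.mk_surjective _ q
    rw [jet_mk, jet_mk, Submodule.Quotient.eq]
    exact h φ

theorem jet_eq_zero_iff {N : ℕ} {T : filtOp ν} :
    jet ν N T = 0 ↔ ∀ φ, T.1 φ ∈ ordGE ν N := by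
  rw [← map_zero (jet ν N), jet_eq_iff]
  simp

theorem filtOp_ext {S T : filtOp ν} (h : ∀ N, jet ν N S = jet ν N T) : S = T :=
  Subtype.ext (LinearMap.ext fun φ => eq_of_forall_sub_mem_ordGE fun N => jet_eq_iff.1 (h N) φ)

theorem jet_neg (N : ℕ) (T : filtOp ν) : jet ν N (-T) = -jet ν N T := by
  ext
  rfl

/-- A family of filtered operators, all but finitely many of which vanish modulo each order. -/
def LocallyFiniteOps {ι : Type*} (T : ι → filtOp ν) : Prop :=
  ∀ N, (Function.support fun i => jet ν N (T i)).Finite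

section FormalSum

variable {ι : Type*} {T : ι → filtOp ν}

theorem coeff_eq_zero_of_jet {N : ℕ} {S : filtOp ν} (h : jet ν N S = 0) (φ : PS ν)
    {d : Var ν →₀ ℕ} (hd : d.degree < N) : coeff d (S.1 φ) = 0 :=
  jet_eq_zero_iff.1 h φ d hd

theorem LocallyFiniteOps.support_subset (c : ι → ℂ) (φ : PS ν) {N : ℕ}
    {d : Var ν →₀ ℕ} (hd : d.degree < N) :
    (Function.support fun i => c i * coeff d ((T i).1 φ)) ⊆
      Function.support fun i => jet ν N (T i) := fun i hi h =>
  hi (by simp only [coeff_eq_zero_of_jet h φ hd, mul_zero])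

theorem LocallyFiniteOps.formallySummable (hT : LocallyFiniteOps T) (c : ι → ℂ) :
    FormallySummable c fun i => ⇑(T i).1 := fun φ d =>
  (hT (d.degree + 1)).subset (support_subset c φ (Nat.lt_succ_self _))

theorem LocallyFiniteOps.formalSum_sub_mem (hT : LocallyFiniteOps T) (c : ι → ℂ) (N : ℕ)
    (φ : PS ν) :
    formalSum c (fun i => ⇑(T i).1) φ - ∑ i ∈ (hT N).toFinset, c i • (T i).1 φ ∈ ordGE ν N := by
  intro d hd
  rw [map_sub, sub_eq_zero, map_sum]
  refine (finsum_eq_sum_of_support_subset _ ?_).trans (Finset.sum_congr rfl fun i _ => ?_)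
  · rw [Set.Finite.coe_toFinset]
    exact support_subset c φ hd
  · rw [map_smul, smul_eq_mul]

/-- The formal sum of a locally finite family, as a filtered operator. -/
def LocallyFiniteOps.sum (hT : LocallyFiniteOps T) (c : ι → ℂ) : filtOp ν :=
  ⟨{ toFun := formalSum c fun i => ⇑(T i).1
     map_add' := fun φ ψ => by
      ext d
      change ∑ᶠ i, c i * coeff d ((T i).1 (φ + ψ)) =
        ∑ᶠ i, c i * coeff d ((T i).1 φ) + ∑ᶠ i, c i * coeff d ((T i).1 ψ)
      rw [← finsum_add_distrib (hT.formallySummable c φ d) (hT.formallySummable c ψ d)]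
      refine finsum_congr fun i => ?_
      rw [map_add, map_add, mul_add]
     map_smul' := fun a φ => by
      ext d
      change ∑ᶠ i, c i * coeff d ((T i).1 (a • φ)) = a * ∑ᶠ i, c i * coeff d ((T i).1 φ)
      rw [mul_finsum' _ _ (hT.formallySummable c φ d)]
      refine finsum_congr fun i => ?_
      rw [map_smul, map_smul, smul_eq_mul, mul_left_comm] },
   fun n φ hφ d hd => by
      change ∑ᶠ i, _ = (0 : ℂ)
      refine finsum_eq_zero_of_forall_eq_zero fun i => ?_
      rw [(T i).2 n φ hφ d hd, mul_zero]⟩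

theorem LocallyFiniteOps.coe_sum (hT : LocallyFiniteOps T) (c : ι → ℂ) :
    ⇑(hT.sum c).1 = formalSum c fun i => ⇑(T i).1 := rfl

theorem LocallyFiniteOps.jet_sum (hT : LocallyFiniteOps T) (c : ι → ℂ) (N : ℕ) :
    jet ν N (hT.sum c) = ∑ᶠ i, c i • jet ν N (T i) := by
  rw [finsum_eq_sum_of_support_subset (s := (hT N).toFinset)]
  · have : ∑ i ∈ (hT N).toFinset, c i • jet ν N (T i) =
        jet ν N (∑ i ∈ (hT N).toFinset, c i • T i) := by
      rw [map_sum]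
      exact Finset.sum_congr rfl fun i _ => (map_smul _ _ _).symm
    rw [this, jet_eq_iff]
    intro φ
    have h := hT.formalSum_sub_mem c N φ
    rw [coe_sum]
    convert h using 2
    simp
  · rw [Set.Finite.coe_toFinset]
    exact fun i hi h => hi (by simp only [h, smul_zero])

end FormalSum

/-! ### Exponentials of operators that raise the order -/

/-- `T` raises the order by at least one. -/
def Raises (T : filtOp ν) : Prop := ∀ n, ∀ φ ∈ ordGE ν n, T.1 φ ∈ ordGE ν (n + 1)

theorem Raises.neg {T : filtOp ν} (hT : Raises T) : Raises (-T) := fun n φ hφ =>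
  Submodule.neg_mem _ (hT n φ hφ)

theorem Raises.pow_mem {T : filtOp ν} (hT : Raises T) (k n : ℕ) {φ : PS ν} (hφ : φ ∈ ordGE ν n) :
    (T.1 ^ k) φ ∈ ordGE ν (n + k) := by
  induction k with
  | zero => exact hφ
  | succ k ih =>
    rw [pow_succ']
    exact hT _ _ ih

theorem jet_list_prod_eq_zero {l : List (filtOp ν)} (hl : ∀ T ∈ l, Raises T) {N : ℕ}
    (hN : N ≤ l.length) : jet ν N l.prod = 0 := by
  have key : ∀ φ, l.prod.1 φ ∈ ordGE ν l.length := by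
    clear hN
    induction l with
    | nil => exact fun φ => mem_ordGE_zero _
    | cons T l ih =>
      intro φ
      rw [List.prod_cons, List.length_cons]
      exact hl T (by simp) _ _ (ih (fun S hS => hl S (by simp [hS])) φ)
  exact jet_eq_zero_iff.2 fun φ => ordGE_anti hN (key φ)

theorem Raises.jet_pow_eq_zero {T : filtOp ν} (hT : Raises T) {N k : ℕ} (h : N ≤ k) :
    jet ν N (T ^ k) = 0 :=
  jet_eq_zero_iff.2 fun φ => by
    have := hT.pow_mem k 0 (mem_ordGE_zero φ)
    exact ordGE_anti (by omega) this

theorem Raises.locallyFinite_pow {T : filtOp ν} (hT : Raises T) :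
    LocallyFiniteOps fun n : ℕ => T ^ n := fun N =>
  (Set.finite_Iio N).subset fun n hn => by
    by_contra h
    exact hn (hT.jet_pow_eq_zero (not_lt.1 h))

/-- The exponential of an operator that raises the order. -/
def Raises.exp {T : filtOp ν} (hT : Raises T) : filtOp ν :=
  hT.locallyFinite_pow.sum fun n => 1 / (n.factorial : ℂ)

theorem Raises.coe_exp {T : filtOp ν} (hT : Raises T) : ⇑hT.exp.1 = expOp ⇑T.1 := by
  rw [exp, LocallyFiniteOps.coe_sum, expOp]
  congr 1
  funext n
  exact Module.End.coe_pow T.1 n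

theorem Raises.jet_exp {T : filtOp ν} (hT : Raises T) (N : ℕ) :
    jet ν N hT.exp = nilExp (jet ν N T) := by
  rw [exp, LocallyFiniteOps.jet_sum, nilExp]
  simp only [map_pow]

theorem Raises.isNilpotent_jet {T : filtOp ν} (hT : Raises T) (N : ℕ) :
    IsNilpotent (jet ν N T) :=
  ⟨N, by rw [← map_pow, hT.jet_pow_eq_zero le_rfl]⟩

theorem Raises.exp_mul_exp_neg {T : filtOp ν} (hT : Raises T) : hT.exp * hT.neg.exp = 1 :=
  filtOp_ext fun N => by
    rw [map_mul, jet_exp, jet_exp, jet_neg, map_one, nilExp_mul_neg (hT.isNilpotent_jet N)]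

theorem Raises.exp_neg_mul_exp {T : filtOp ν} (hT : Raises T) : hT.neg.exp * hT.exp = 1 :=
  filtOp_ext fun N => by
    have h := nilExp_mul_neg (hT.neg.isNilpotent_jet N)
    rw [jet_neg, neg_neg] at h
    rw [map_mul, jet_exp, jet_exp, jet_neg, map_one, h]

theorem Raises.exp_sub_sum_mem {T : filtOp ν} (hT : Raises T) (K n : ℕ) {φ : PS ν}
    (hφ : φ ∈ ordGE ν n) :
    hT.exp.1 φ - ∑ k ∈ Finset.range K, (1 / (k.factorial : ℂ)) • (T.1 ^ k) φ ∈
      ordGE ν (n + K) := by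
  intro d hd
  rw [map_sub, sub_eq_zero, map_sum]
  refine (finsum_eq_sum_of_support_subset _ ?_).trans (Finset.sum_congr rfl fun i _ => ?_)
  · intro k hk
    by_contra h
    simp only [Finset.coe_range, Set.mem_Iio, not_lt] at h
    refine hk ?_
    have h0 : coeff d ((T.1 ^ k) φ) = 0 := hT.pow_mem k n hφ d (by omega)
    change _ * coeff d ((T.1 ^ k) φ) = 0
    rw [h0, mul_zero]
  · rw [map_smul, smul_eq_mul]
    rfl

theorem Raises.exp_sub_self_mem {T : filtOp ν} (hT : Raises T) (n : ℕ) {φ : PS ν}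
    (hφ : φ ∈ ordGE ν n) : hT.exp.1 φ - φ ∈ ordGE ν (n + 1) := by
  simpa using hT.exp_sub_sum_mem 1 n hφ

theorem pow_apply_bilin (T : Module.End ℂ (PS ν)) (b : PS ν →ₗ[ℂ] PS ν →ₗ[ℂ] PS ν)
    (hb : ∀ f g, T (b f g) = b (T f) g + b f (T g)) (n : ℕ) (f g : PS ν) :
    (1 / (n.factorial : ℂ)) • (T ^ n) (b f g) =
      ∑ p ∈ Finset.HasAntidiagonal.antidiagonal n, b ((1 / (p.1.factorial : ℂ)) • (T ^ p.1) f)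
        ((1 / (p.2.factorial : ℂ)) • (T ^ p.2) g) := by
  -- On the tensor square, `T ⊗ 1` and `1 ⊗ T` commute, so the binomial formula applies.
  set m := TensorProduct.lift b with hm
  set S : Module.End ℂ (TensorProduct ℂ (PS ν) (PS ν)) := TensorProduct.map T LinearMap.id with hS
  set S' : Module.End ℂ (TensorProduct ℂ (PS ν) (PS ν)) := TensorProduct.map LinearMap.id T with hS'
  have hcomm : Commute S S' := by
    refine TensorProduct.ext' fun x y => ?_
    simp [hS, hS']
  have hint : ∀ k : ℕ, ∀ t, (T ^ k) (m t) = m (((S + S') ^ k) t) := by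
    intro k
    induction k with
    | zero => simp
    | succ k ih =>
      intro t
      rw [pow_succ, Module.End.mul_apply, pow_succ, Module.End.mul_apply, ← ih]
      congr 1
      have : T ∘ₗ m = m ∘ₗ (S + S') := by
        refine TensorProduct.ext' fun x y => ?_
        simp [hm, hS, hS', hb]
      exact LinearMap.congr_fun this t
  have hpow : ∀ k, S ^ k = TensorProduct.map (T ^ k) LinearMap.id := fun k => by
    rw [hS, TensorProduct.map_pow]; congr 1; exact one_pow k
  have hpow' : ∀ k, S' ^ k = TensorProduct.map LinearMap.id (T ^ k) := fun k => by
    rw [hS', TensorProduct.map_pow]; congr 1; exact one_pow k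
  have h := hint n (TensorProduct.tmul ℂ f g)
  rw [hm, TensorProduct.lift.tmul] at h
  rw [h, hcomm.add_pow', LinearMap.sum_apply, map_sum, Finset.smul_sum]
  refine Finset.sum_congr rfl fun p hp => ?_
  have hp' : p.1 + p.2 = n := Finset.HasAntidiagonal.mem_antidiagonal.1 hp
  rw [LinearMap.smul_apply, Module.End.mul_apply, hpow, hpow', TensorProduct.map_tmul,
    TensorProduct.map_tmul, map_nsmul, TensorProduct.lift.tmul]
  simp only [LinearMap.id_apply, map_smul, LinearMap.smul_apply]
  rw [← Nat.cast_smul_eq_nsmul ℂ, smul_smul, smul_smul]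
  congr 1
  rw [← hp', Nat.cast_add_choose]
  have h1 : ((p.1 + p.2).factorial : ℂ) ≠ 0 := Nat.cast_ne_zero.2 (Nat.factorial_ne_zero _)
  field_simp

/-- If an order-raising operator obeys the Leibniz rule for a bilinear operation that lowers the
order by at most two, then its exponential is an automorphism of that operation. -/
theorem Raises.exp_bilin {T : filtOp ν} (hT : Raises T) (b : PS ν →ₗ[ℂ] PS ν →ₗ[ℂ] PS ν)
    (hord : ∀ m n f g, f ∈ ordGE ν m → g ∈ ordGE ν n → b f g ∈ ordGE ν (m + n - 2))
    (hb : ∀ f g, T.1 (b f g) = b (T.1 f) g + b f (T.1 g)) (f g : PS ν) :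
    hT.exp.1 (b f g) = b (hT.exp.1 f) (hT.exp.1 g) := by
  refine eq_of_forall_sub_mem_ordGE fun N => ?_
  set K := N + 2 with hK
  set e : ℕ → PS ν → PS ν := fun k φ => (1 / (k.factorial : ℂ)) • (T.1 ^ k) φ with he
  have hmem : ∀ k φ, e k φ ∈ ordGE ν k := fun k φ => by
    have := hT.pow_mem k 0 (mem_ordGE_zero φ)
    rw [zero_add] at this
    exact Submodule.smul_mem _ _ this
  have hE : ∀ φ, hT.exp.1 φ - ∑ k ∈ Finset.range K, e k φ ∈ ordGE ν K := fun φ => by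
    have := hT.exp_sub_sum_mem K 0 (mem_ordGE_zero φ)
    rwa [zero_add] at this
  have h1 : hT.exp.1 (b f g) - ∑ k ∈ Finset.range K, e k (b f g) ∈ ordGE ν N :=
    ordGE_anti (by omega) (hE _)
  have h2 : b (hT.exp.1 f) (hT.exp.1 g)
      - b (∑ k ∈ Finset.range K, e k f) (∑ k ∈ Finset.range K, e k g) ∈ ordGE ν N := by
    have : b (hT.exp.1 f) (hT.exp.1 g)
        - b (∑ k ∈ Finset.range K, e k f) (∑ k ∈ Finset.range K, e k g)
        = b (hT.exp.1 f - ∑ k ∈ Finset.range K, e k f) (hT.exp.1 g)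
          + b (∑ k ∈ Finset.range K, e k f) (hT.exp.1 g - ∑ k ∈ Finset.range K, e k g) := by
      simp only [map_sub, LinearMap.sub_apply]
      abel
    rw [this]
    refine Submodule.add_mem _ ?_ ?_
    · exact ordGE_anti (by omega) (hord K 0 _ _ (hE f) (mem_ordGE_zero _))
    · exact ordGE_anti (by omega) (hord 0 K _ _ (mem_ordGE_zero _) (hE g))
  have h3 : b (∑ k ∈ Finset.range K, e k f) (∑ k ∈ Finset.range K, e k g)
      - ∑ k ∈ Finset.range K, e k (b f g) ∈ ordGE ν N := by
    have hl : ∑ k ∈ Finset.range K, e k (b f g) =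
        ∑ p ∈ Finset.range K ×ˢ Finset.range K with p.1 + p.2 < K, b (e p.1 f) (e p.2 g) := by
      rw [← Finset.sum_fiberwise_of_maps_to (t := Finset.range K)
        (g := fun p : ℕ × ℕ => p.1 + p.2)]
      · refine Finset.sum_congr rfl fun n hn => ?_
        rw [he]
        simp only
        rw [pow_apply_bilin T.1 b hb]
        refine Finset.sum_congr ?_ fun _ _ => rfl
        ext p
        simp only [Finset.HasAntidiagonal.mem_antidiagonal, Finset.mem_filter, Finset.mem_product,
          Finset.mem_range] at hn ⊢
        omega
      · intro p hp
        simpa using (Finset.mem_filter.1 hp).2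
    have hr : b (∑ k ∈ Finset.range K, e k f) (∑ k ∈ Finset.range K, e k g) =
        ∑ p ∈ Finset.range K ×ˢ Finset.range K, b (e p.1 f) (e p.2 g) := by
      rw [Finset.sum_product, map_sum b, LinearMap.sum_apply]
      exact Finset.sum_congr rfl fun i _ => map_sum (b (e i f)) _ _
    rw [hl, hr, ← Finset.sum_filter_add_sum_filter_not _ (fun p : ℕ × ℕ => p.1 + p.2 < K),
      add_sub_cancel_left]
    refine Submodule.sum_mem _ fun p hp => ?_
    have hp' := (Finset.mem_filter.1 hp).2
    exact ordGE_anti (by omega) (hord _ _ _ _ (hmem p.1 f) (hmem p.2 g))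
  have h4 := Submodule.sub_mem _ (Submodule.sub_mem _ h1 h2) h3
  convert h4 using 1
  abel

end Filtration

/-! ### The Poisson bracket -/

section Poisson

variable {ν : ℕ}

theorem pderiv_comm (s t : Var ν) (f : PS ν) :
    MvPowerSeries.pderiv ℂ s (MvPowerSeries.pderiv ℂ t f) =
      MvPowerSeries.pderiv ℂ t (MvPowerSeries.pderiv ℂ s f) := by
  ext d
  rcases eq_or_ne s t with rfl | h
  · rfl
  · simp only [coeff_pderiv, Finsupp.add_apply, Finsupp.single_eq_of_ne h,
      Finsupp.single_eq_of_ne h.symm, add_zero]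
    rw [add_right_comm]
    ring

/-- The Poisson bracket as a bilinear map. -/
def poissonBilin (ν : ℕ) : PS ν →ₗ[ℂ] PS ν →ₗ[ℂ] PS ν :=
  LinearMap.mk₂ ℂ poisson
    (fun f f' g => by
      simp only [poisson, map_add, ← Finset.sum_add_distrib]
      exact Finset.sum_congr rfl fun i _ => by ring)
    (fun c f g => by
      simp only [poisson, Derivation.map_smul, Finset.smul_sum, smul_mul_assoc, smul_sub])
    (fun f g g' => by
      simp only [poisson, map_add, ← Finset.sum_add_distrib]
      exact Finset.sum_congr rfl fun i _ => by ring)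
    (fun c f g => by
      simp only [poisson, Derivation.map_smul, Finset.smul_sum, mul_smul_comm, smul_sub])

theorem poisson_leibniz (f g h : PS ν) :
    poisson f (g * h) = poisson f g * h + g * poisson f h := by
  simp only [poisson, Finset.sum_mul, Finset.mul_sum, ← Finset.sum_add_distrib,
    Derivation.leibniz, smul_eq_mul]
  exact Finset.sum_congr rfl fun i _ => by ring

theorem poisson_antisymm (f g : PS ν) : poisson f g = -poisson g f := by
  simp only [poisson, ← Finset.sum_neg_distrib]
  exact Finset.sum_congr rfl fun i _ => by ring

theorem poisson_mem_ordGE {m n : ℕ} {f g : PS ν} (hf : f ∈ ordGE ν m) (hg : g ∈ ordGE ν n) :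
    poisson f g ∈ ordGE ν (m + n - 2) :=
  Submodule.sum_mem _ fun i _ => ordGE_anti (show m + n - 2 ≤ m - 1 + (n - 1) by omega)
    (Submodule.sub_mem _
      (mul_mem_ordGE (pderiv_mem_ordGE hf _) (pderiv_mem_ordGE hg _))
      (mul_mem_ordGE (pderiv_mem_ordGE hf _) (pderiv_mem_ordGE hg _)))

theorem poisson_poisson (f g h : PS ν) :
    poisson f (poisson g h) = ∑ i : Fin ν, ∑ j : Fin ν,
      (pderiv ℂ (.inl i) f *
          (pderiv ℂ (.inr i) (pderiv ℂ (.inl j) g) * pderiv ℂ (.inr j) h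
          + pderiv ℂ (.inl j) g * pderiv ℂ (.inr i) (pderiv ℂ (.inr j) h)
          - pderiv ℂ (.inr i) (pderiv ℂ (.inr j) g) * pderiv ℂ (.inl j) h
          - pderiv ℂ (.inr j) g * pderiv ℂ (.inr i) (pderiv ℂ (.inl j) h))
        - pderiv ℂ (.inr i) f *
          (pderiv ℂ (.inl i) (pderiv ℂ (.inl j) g) * pderiv ℂ (.inr j) h
          + pderiv ℂ (.inl j) g * pderiv ℂ (.inl i) (pderiv ℂ (.inr j) h)
          - pderiv ℂ (.inl i) (pderiv ℂ (.inr j) g) * pderiv ℂ (.inl j) h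
          - pderiv ℂ (.inr j) g * pderiv ℂ (.inl i) (pderiv ℂ (.inl j) h))) := by
  unfold poisson
  refine Finset.sum_congr rfl fun i _ => ?_
  rw [map_sum, map_sum, Finset.mul_sum, Finset.mul_sum, ← Finset.sum_sub_distrib]
  refine Finset.sum_congr rfl fun j _ => ?_
  simp only [map_sub, Derivation.leibniz, smul_eq_mul]
  ring

/-- The Jacobi identity: `{f, ·}` is a derivation of the Poisson bracket. -/
theorem poisson_jacobi (f g h : PS ν) :
    poisson f (poisson g h) = poisson (poisson f g) h + poisson g (poisson f h) := by
  rw [poisson_antisymm (poisson f g) h, neg_add_eq_sub, eq_sub_iff_add_eq, ← sub_eq_zero,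
    poisson_poisson, poisson_poisson, poisson_poisson]
  simp only [← Finset.sum_add_distrib, ← Finset.sum_sub_distrib]
  -- The summand for `(i, j)` is opposite to the one for `(j, i)`.
  have half : ∀ S : PS ν, S = -S → S = 0 := fun S hS => by
    have h2 : (2 : ℂ) • S = 0 := by rw [two_smul, ← eq_neg_iff_add_eq_zero]; exact hS
    rw [← inv_smul_smul₀ (two_ne_zero (α := ℂ)) S, h2, smul_zero]
  refine half _ ?_
  rw [← Finset.sum_neg_distrib]
  refine Finset.sum_comm.trans ?_
  refine Finset.sum_congr rfl fun i _ => ?_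
  rw [← Finset.sum_neg_distrib]
  refine Finset.sum_congr rfl fun j _ => ?_
  simp only [pderiv_comm (.inl j) (.inl i), pderiv_comm (.inr j) (.inr i),
    pderiv_comm (.inl _) (.inr _)]
  ring

/-! ### The linear part -/

theorem coeff_X_mul_pderiv (s : Var ν) (φ : PS ν) (d : Var ν →₀ ℕ) :
    coeff d (X s * pderiv ℂ s φ) = d s * coeff d φ := by
  rw [X, coeff_monomial_mul]
  split_ifs with h
  · rw [coeff_pderiv, one_mul, tsub_add_cancel_of_le h, mul_comm]
    congr 1
    have h1 : 1 ≤ d s := by simpa using h s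
    rw [Finsupp.tsub_apply, Finsupp.single_eq_same]
    push_cast [Nat.cast_sub h1]
    ring
  · have : d s = 0 := by
      by_contra h0
      exact h (by rw [Finsupp.single_le_iff]; omega)
    rw [this, Nat.cast_zero, zero_mul]

theorem coeff_linField (lam : Fin ν → ℂ) (φ : PS ν) (d : Var ν →₀ ℕ) :
    coeff d (linField lam φ) = weight lam d * coeff d φ := by
  simp only [linField, weight, map_add, map_neg, map_sum, mul_assoc, coeff_C_mul,
    coeff_X_mul_pderiv, Finset.sum_mul, ← Finset.sum_neg_distrib, ← Finset.sum_add_distrib]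
  exact Finset.sum_congr rfl fun i _ => by ring

theorem hamField_quadPart (lam : Fin ν → ℂ) : hamField (quadPart lam) = linField lam := by
  classical
  funext φ
  have hl : ∀ i, pderiv ℂ (.inl i) (quadPart lam) = C (lam i) * X (.inr i) := by
    intro i
    rw [quadPart, map_sum, Finset.sum_eq_single i]
    · simp [Derivation.leibniz, pderiv_X_of_ne]
      ring
    · intro j _ hj
      simp [Derivation.leibniz, pderiv_X_of_ne, hj]
    · simp
  have hr : ∀ i, pderiv ℂ (.inr i) (quadPart lam) = C (lam i) * X (.inl i) := by
    intro i
    rw [quadPart, map_sum, Finset.sum_eq_single i]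
    · simp [Derivation.leibniz, pderiv_X_of_ne]
    · intro j _ hj
      simp [Derivation.leibniz, pderiv_X_of_ne, hj]
    · simp
  simp only [hamField, poisson, hl, hr, linField, ← Finset.sum_neg_distrib,
    ← Finset.sum_add_distrib]
  exact Finset.sum_congr rfl fun i _ => by ring

theorem coeff_quadPart_eq_zero (lam : Fin ν → ℂ) {d : Var ν →₀ ℕ} (hd : d.degree ≠ 2) :
    coeff d (quadPart lam) = 0 := by
  classical
  rw [quadPart, map_sum]
  refine Finset.sum_eq_zero fun i _ => ?_
  rw [mul_assoc, coeff_C_mul, X, X, monomial_mul_monomial, coeff_monomial, if_neg, mul_zero]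
  rintro rfl
  exact hd (by simp)

theorem quadPart_mem_ordGE (lam : Fin ν → ℂ) : quadPart lam ∈ ordGE ν 2 := fun _ hd =>
  coeff_quadPart_eq_zero lam hd.ne

theorem isHamiltonian_iff {lam : Fin ν → ℂ} {H : PS ν} :
    IsHamiltonian lam H ↔ H - quadPart lam ∈ ordGE ν 3 := by
  simp only [IsHamiltonian, mem_ordGE, map_sub, sub_eq_zero, Nat.lt_succ_iff]

theorem IsHamiltonian.mem_ordGE {lam : Fin ν → ℂ} {H : PS ν} (hH : IsHamiltonian lam H) :
    H ∈ ordGE ν 2 := by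
  rw [← sub_add_cancel H (quadPart lam)]
  exact Submodule.add_mem _ (ordGE_anti (by norm_num) (isHamiltonian_iff.1 hH))
    (quadPart_mem_ordGE lam)

/-! ### Hamiltonian vector fields as filtered operators -/

/-- The vector field `X_f` of a series without terms of degree less than two, as a filtered
operator. -/
def hamOp (ν : ℕ) : ordGE ν 2 →ₗ[ℂ] filtOp ν where
  toFun f := ⟨poissonBilin ν f.1, fun n φ hφ => by
    have := poisson_mem_ordGE f.2 hφ
    rwa [Nat.add_sub_cancel_left] at this⟩
  map_add' f g := Subtype.ext (map_add _ _ _)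
  map_smul' c f := Subtype.ext (map_smul _ _ _)

theorem coe_hamOp (f : ordGE ν 2) : ⇑(hamOp ν f).1 = hamField f.1 := rfl

theorem raises_hamOp {f : ordGE ν 2} (hf : f.1 ∈ ordGE ν 3) : Raises (hamOp ν f) := fun n φ hφ => by
  have := poisson_mem_ordGE hf hφ
  rwa [show 3 + n - 2 = n + 1 by omega] at this

theorem jet_hamOp_eq_zero {f : ordGE ν 2} {N : ℕ} (hf : f.1 ∈ ordGE ν (N + 2)) :
    jet ν N (hamOp ν f) = 0 :=
  jet_eq_zero_iff.2 fun φ => poisson_mem_ordGE hf (mem_ordGE_zero φ)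

/-- Hamiltonians are determined by their vector fields, because their constant terms vanish. -/
theorem IsHamiltonian.eq_of_hamField_eq {lam : Fin ν → ℂ} {f g : PS ν} (hf : IsHamiltonian lam f)
    (hg : IsHamiltonian lam g) (h : hamField f = hamField g) : f = g := by
  classical
  have hl : ∀ (f : PS ν) i, hamField f (X (.inl i)) = -pderiv ℂ (.inr i) f := by
    intro f i
    rw [hamField, poisson, Finset.sum_eq_single i]
    · simp [pderiv_X_of_ne]
    · intro j _ hj
      simp [pderiv_X_of_ne, hj.symm]
    · simp
  have hr : ∀ (f : PS ν) i, hamField f (X (.inr i)) = pderiv ℂ (.inl i) f := by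
    intro f i
    rw [hamField, poisson, Finset.sum_eq_single i]
    · simp [pderiv_X_of_ne]
    · intro j _ hj
      simp [pderiv_X_of_ne, hj.symm]
    · simp
  refine MvPowerSeries.pderiv.ext ?_ ?_
  · rintro (i | i)
    · rw [← hr, ← hr, h]
    · rw [← neg_inj, ← hl, ← hl, h]
  · rw [← coeff_zero_eq_constantCoeff_apply, ← coeff_zero_eq_constantCoeff_apply,
      hf 0 (by simp), hg 0 (by simp)]

end Poisson

/-! ### Exponentials of Hamiltonian vector fields are canonical transformations -/

section Canonical

variable {ν : ℕ}

theorem subst_mem_ordGE {h : Var ν → PS ν} (h0 : ∀ s, constantCoeff (h s) = 0) {n : ℕ}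
    {φ : PS ν} (hφ : φ ∈ ordGE ν n) : subst h φ ∈ ordGE ν n := by
  intro e he
  rw [coeff_subst (hasSubst_of_constantCoeff_zero h0)]
  refine finsum_eq_zero_of_forall_eq_zero fun d => ?_
  rcases lt_or_ge d.degree n with hd | hd
  · rw [hφ d hd, zero_smul]
  · have : (d.degree : ℕ∞) ≤ (d.prod fun s k => h s ^ k).order := by
      refine le_trans ?_ (le_order_prod _ _)
      rw [Finsupp.degree_apply, Nat.cast_sum]
      exact Finset.sum_le_sum fun s _ => le_order_pow_of_constantCoeff_eq_zero _ (h0 s)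
    rw [coeff_of_lt_order (lt_of_lt_of_le (by exact_mod_cast he.trans_le hd) this), smul_zero]

/-- An algebra endomorphism that preserves the order filtration is a substitution: both agree on
polynomials. -/
theorem algHom_eq_subst (Θ : PS ν →ₐ[ℂ] PS ν) (hΘ : ∀ n, ∀ φ ∈ ordGE ν n, Θ φ ∈ ordGE ν n)
    (h0 : ∀ s, constantCoeff (Θ (X s)) = 0) (φ : PS ν) :
    Θ φ = subst (fun s => Θ (X s)) φ := by
  have hs := hasSubst_of_constantCoeff_zero h0
  refine eq_of_forall_sub_mem_ordGE fun N => ?_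
  set p := truncTotal N φ with hp
  have hpol : Θ p = subst (fun s => Θ (X s)) (p : PS ν) := by
    rw [subst_coe]
    have : Θ.comp (MvPolynomial.coeToMvPowerSeries.algHom ℂ) =
        MvPolynomial.aeval fun s => Θ (X s) := by
      refine MvPolynomial.algHom_ext fun s => ?_
      simp
    have h := DFunLike.congr_fun this p
    simpa using h
  have hrem : φ - p ∈ ordGE ν N := by
    intro d hd
    rw [map_sub, MvPolynomial.coeff_coe, hp, coeff_truncTotal _ hd, sub_self]
  have e : Θ φ - subst (fun s => Θ (X s)) φ =
      Θ (φ - p) - subst (fun s => Θ (X s)) (φ - (p : PS ν)) := by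
    rw [map_sub, subst_sub hs, hpol]
    abel
  rw [e]
  exact Submodule.sub_mem _ (hΘ N _ hrem) (subst_mem_ordGE h0 hrem)

variable {G : ordGE ν 2} (hG : G.1 ∈ ordGE ν 3)

theorem exp_hamOp_poisson (f g : PS ν) :
    (raises_hamOp hG).exp.1 (poisson f g) =
      poisson ((raises_hamOp hG).exp.1 f) ((raises_hamOp hG).exp.1 g) :=
  (raises_hamOp hG).exp_bilin (poissonBilin ν) (fun _ _ _ _ hf hg => poisson_mem_ordGE hf hg)
    (fun f g => poisson_jacobi G.1 f g) f g

theorem exp_hamOp_mul (f g : PS ν) :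
    (raises_hamOp hG).exp.1 (f * g) =
      (raises_hamOp hG).exp.1 f * (raises_hamOp hG).exp.1 g :=
  (raises_hamOp hG).exp_bilin (LinearMap.mul ℂ (PS ν))
    (fun _ _ _ _ hf hg => ordGE_anti (Nat.sub_le _ _) (mul_mem_ordGE hf hg))
    (fun f g => poisson_leibniz G.1 f g) f g

theorem exp_hamOp_leftInverse :
    Function.LeftInverse (raises_hamOp hG).neg.exp.1 (raises_hamOp hG).exp.1 := fun φ =>
  LinearMap.congr_fun (congrArg Subtype.val (raises_hamOp hG).exp_neg_mul_exp) φ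

theorem exp_hamOp_rightInverse :
    Function.RightInverse (raises_hamOp hG).neg.exp.1 (raises_hamOp hG).exp.1 := fun φ =>
  LinearMap.congr_fun (congrArg Subtype.val (raises_hamOp hG).exp_mul_exp_neg) φ

theorem exp_hamOp_one : (raises_hamOp hG).exp.1 1 = 1 := by
  have h := exp_hamOp_mul hG 1 ((raises_hamOp hG).neg.exp.1 1)
  rw [one_mul, exp_hamOp_rightInverse hG 1, mul_one] at h
  exact h.symm

theorem isCanonical_exp_hamOp : IsCanonical (raises_hamOp hG).exp.1 := by
  set Θ := (raises_hamOp hG).exp with hΘ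
  have htan : ∀ s d, d.degree ≤ 1 → coeff d (Θ.1 (X s)) = coeff d (X s : PS ν) := by
    intro s d hd
    have hX : (X s : PS ν) ∈ ordGE ν 1 := by
      intro e he
      have : e = 0 := by rwa [Nat.lt_one_iff, Finsupp.degree_eq_zero_iff] at he
      rw [this, coeff_zero_eq_constantCoeff_apply, constantCoeff_X]
    rw [← sub_eq_zero, ← map_sub]
    exact (raises_hamOp hG).exp_sub_self_mem 1 hX d (by omega)
  refine ⟨⟨fun s => Θ.1 (X s), htan, fun φ => ?_⟩,
    ⟨(exp_hamOp_leftInverse hG).injective, (exp_hamOp_rightInverse hG).surjective⟩,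
    exp_hamOp_poisson hG⟩
  exact algHom_eq_subst (AlgHom.ofLinearMap Θ.1 (exp_hamOp_one hG) (exp_hamOp_mul hG))
    (fun n ψ hψ => Θ.2 n ψ hψ)
    (fun s => (htan s 0 (by simp)).trans (by simp)) φ

/-- Conjugation by a canonical transformation `Θ` carries `X_K` to `X_{ΘK}`. -/
theorem exp_hamOp_conj (K : PS ν) :
    (raises_hamOp hG).exp.1 ∘ hamField K ∘ (raises_hamOp hG).neg.exp.1 =
      hamField ((raises_hamOp hG).exp.1 K) := by
  funext φ
  simp only [Function.comp_apply, hamField]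
  rw [exp_hamOp_poisson hG, exp_hamOp_rightInverse hG φ]

end Canonical

/-! ### The operators attached to the letters -/

section Letters

variable {ν : ℕ} (lam : Fin ν → ℂ) (H : PS ν)

theorem formalSum_comp {ι κ : Type*} {e : ι → κ} (he : Function.Injective e) (c : κ → ℂ)
    (T : κ → Op ν) (h : ∀ k ∉ Set.range e, ∀ φ, c k • T k φ = 0) :
    formalSum (fun i => c (e i)) (fun i => T (e i)) = formalSum c T := by
  funext φ d
  change ∑ᶠ i, c (e i) * coeff d (T (e i) φ) = ∑ᶠ k, c k * coeff d (T k φ)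
  have hsub : (Function.support fun k => c k * coeff d (T k φ)) ⊆ Set.range e := by
    intro k hk
    by_contra hn
    refine hk ?_
    change c k * coeff d (T k φ) = 0
    rw [← smul_eq_mul, ← map_smul, h k hn, map_zero]
  rw [← finsum_mem_univ (f := fun k => c k * coeff d (T k φ)),
    ← finsum_mem_inter_support_eq' _ (Set.range e), finsum_mem_range he]
  intro k hk
  simp [hsub hk]

/-- The Hamiltonian with coefficients `c(ω(n, m)) a_{nm}` on the monomials of degree at least
three. -/
def weightScale (c : ℂ → ℂ) : PS ν :=
  fun d => if 3 ≤ d.degree then c (weight lam d) * coeff d H else 0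

theorem coeff_weightScale (c : ℂ → ℂ) (d : Var ν →₀ ℕ) :
    coeff d (weightScale lam H c) = if 3 ≤ d.degree then c (weight lam d) * coeff d H else 0 := rfl

theorem coeff_component (ω : ℂ) (d : Var ν →₀ ℕ) :
    coeff d (component lam H ω) =
      if 3 ≤ d.degree ∧ weight lam d = ω then coeff d H else 0 := by
  change component lam H ω d = _
  rw [component]
  by_cases h : coeff d H = 0
  · simp [h]
  · simp [higherExponents, h]

theorem weightScale_mem (c : ℂ → ℂ) : weightScale lam H c ∈ ordGE ν 3 := fun d hd => by
  rw [coeff_weightScale, if_neg (by omega)]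

theorem component_mem (ω : ℂ) : component lam H ω ∈ ordGE ν 3 := fun d hd => by
  rw [coeff_component, if_neg (by omega)]

/-- `∑ c(ω) 𝔇_ω`, as a filtered operator. -/
def scaleOp (c : ℂ → ℂ) : filtOp ν :=
  hamOp ν ⟨weightScale lam H c, ordGE_anti (by norm_num) (weightScale_mem lam H c)⟩

/-- `𝔇_ω`, as a filtered operator; it vanishes for `ω` outside the alphabet. -/
def letterOp (ω : ℂ) : filtOp ν :=
  hamOp ν ⟨component lam H ω, ordGE_anti (by norm_num) (component_mem lam H ω)⟩

/-- `X_lin`, as a filtered operator. -/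
def linOp : filtOp ν := hamOp ν ⟨quadPart lam, quadPart_mem_ordGE lam⟩

theorem coe_linOp : ⇑(linOp lam).1 = linField lam := hamField_quadPart lam

theorem raises_scaleOp (c : ℂ → ℂ) : Raises (scaleOp lam H c) :=
  raises_hamOp (weightScale_mem lam H c)

theorem raises_letterOp (ω : ℂ) : Raises (letterOp lam H ω) :=
  raises_hamOp (component_mem lam H ω)

theorem letterOp_eq_zero {ω : ℂ} (hω : ω ∉ alphabet lam H) : letterOp lam H ω = 0 := by
  rw [letterOp, ← map_zero (hamOp ν)]
  congr 1
  refine Subtype.ext ?_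
  ext d
  change component lam H ω d = 0
  rw [component, if_neg]
  rintro ⟨h1, h2⟩
  exact hω ⟨d, h1, h2⟩

theorem finite_degree_lt (N : ℕ) : {d : Var ν →₀ ℕ | d.degree < N}.Finite :=
  (Finsupp.finite_of_degree_le N).subset fun d (hd : d.degree < N) => hd.le

/-- The weights of the monomials of degree less than `N`. -/
def weightsLT (N : ℕ) : Finset ℂ :=
  open Classical in (finite_degree_lt (ν := ν) N).toFinset.image (weight lam)

theorem weight_mem_weightsLT {N : ℕ} {d : Var ν →₀ ℕ} (hd : d.degree < N) :
    weight lam d ∈ weightsLT lam N :=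
  Finset.mem_image_of_mem _ (by simpa using hd)

theorem jet_letterOp_eq_zero {N : ℕ} {ω : ℂ} (hω : ω ∉ weightsLT lam (N + 2)) :
    jet ν N (letterOp lam H ω) = 0 := by
  refine jet_hamOp_eq_zero fun d hd => ?_
  rw [coeff_component, if_neg]
  rintro ⟨-, rfl⟩
  exact hω (weight_mem_weightsLT lam hd)

theorem support_jet_letterOp (N : ℕ) :
    (Function.support fun ω => jet ν N (letterOp lam H ω)) ⊆ weightsLT lam (N + 2) := fun ω hω => by
  by_contra h
  exact hω (jet_letterOp_eq_zero lam H (by simpa using h))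

theorem locallyFinite_letterOp : LocallyFiniteOps (letterOp lam H) := fun N =>
  (Finset.finite_toSet _).subset (support_jet_letterOp lam H N)

theorem jet_scaleOp (c : ℂ → ℂ) (N : ℕ) :
    jet ν N (scaleOp lam H c) = ∑ᶠ ω, c ω • jet ν N (letterOp lam H ω) := by
  classical
  rw [finsum_eq_sum_of_support_subset (s := weightsLT lam (N + 2))]
  · have h1 : ∑ ω ∈ weightsLT lam (N + 2), c ω • jet ν N (letterOp lam H ω) =
        jet ν N (∑ ω ∈ weightsLT lam (N + 2), c ω • letterOp lam H ω) := by
      rw [map_sum]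
      exact Finset.sum_congr rfl fun ω _ => (map_smul _ _ _).symm
    have h2 : ∑ ω ∈ weightsLT lam (N + 2), c ω • letterOp lam H ω =
        hamOp ν (∑ ω ∈ weightsLT lam (N + 2), c ω •
          ⟨component lam H ω, ordGE_anti (by norm_num) (component_mem lam H ω)⟩) := by
      rw [map_sum]
      exact Finset.sum_congr rfl fun ω _ => (map_smul _ _ _).symm
    rw [h1, h2, ← sub_eq_zero, scaleOp, ← map_sub (jet ν N), ← map_sub (hamOp ν)]
    refine jet_hamOp_eq_zero fun d hd => ?_
    rw [Submodule.coe_sub, Submodule.coe_sum, map_sub, map_sum, sub_eq_zero, coeff_weightScale,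
      Finset.sum_eq_single (weight lam d)]
    · rw [Submodule.coe_smul, map_smul, coeff_component, smul_eq_mul]
      simp
    · intro ω _ hω
      rw [Submodule.coe_smul, map_smul, coeff_component, if_neg (fun h => hω h.2.symm), smul_zero]
    · exact fun h => absurd (weight_mem_weightsLT lam hd) h
  · intro ω hω
    by_contra h
    refine hω ?_
    simp only [jet_letterOp_eq_zero lam H (N := N) (by simpa using h), smul_zero]

theorem scaleOp_eq_sum (c : ℂ → ℂ) :
    scaleOp lam H c = (locallyFinite_letterOp lam H).sum c :=
  filtOp_ext fun N => by rw [jet_scaleOp, LocallyFiniteOps.jet_sum]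

theorem coe_scaleOp_eq_alphabet_sum (c : ℂ → ℂ) :
    ⇑(scaleOp lam H c).1 = formalSum (fun ω : alphabet lam H => c ω) (frakD lam H) := by
  rw [scaleOp_eq_sum, LocallyFiniteOps.coe_sum]
  refine (formalSum_comp Subtype.val_injective c (fun ω => ⇑(letterOp lam H ω).1) ?_).symm
  intro ω hω φ
  rw [Subtype.range_coe] at hω
  rw [letterOp_eq_zero lam H hω]
  exact smul_zero _

theorem coe_scaleOp_eq_generator (s : ℂ) :
    ⇑(scaleOp lam H fun ω => s / ω).1 = generator lam H s := by
  rw [scaleOp_eq_sum, LocallyFiniteOps.coe_sum]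
  refine (formalSum_comp
    (e := fun ω : {ω : alphabet lam H // (ω : ℂ) ≠ 0} => (ω.1 : ℂ))
    (Subtype.val_injective.comp Subtype.val_injective) (fun ω => s / ω)
    (fun ω => ⇑(letterOp lam H ω).1) ?_).symm
  intro ω hω φ
  by_cases h : ω ∈ alphabet lam H
  · -- The only other letter is `0`, where the coefficient `s / 0` is `0`.
    have h0 : ω = 0 := by
      by_contra h0
      exact hω ⟨⟨⟨ω, h⟩, h0⟩, rfl⟩
    rw [h0, div_zero, zero_smul]
  · rw [letterOp_eq_zero lam H h]
    exact smul_zero _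

theorem neg_scaleOp (c : ℂ → ℂ) : -scaleOp lam H c = scaleOp lam H fun ω => -c ω := by
  have h : weightScale lam H (fun ω => -c ω) = -weightScale lam H c := by
    ext d
    rw [map_neg, coeff_weightScale, coeff_weightScale]
    split_ifs <;> simp
  refine Subtype.ext (LinearMap.ext fun φ => ?_)
  change -poissonBilin ν (weightScale lam H c) φ = poissonBilin ν (weightScale lam H _) φ
  rw [h, map_neg, LinearMap.neg_apply]

theorem linOp_commutator (ω : ℂ) :
    linOp lam * letterOp lam H ω - letterOp lam H ω * linOp lam = ω • letterOp lam H ω := by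
  refine Subtype.ext (LinearMap.ext fun φ => ?_)
  change poisson (quadPart lam) (poisson (component lam H ω) φ)
    - poisson (component lam H ω) (poisson (quadPart lam) φ) =
    ω • poisson (component lam H ω) φ
  have h : poisson (quadPart lam) (component lam H ω) = ω • component lam H ω := by
    have := congrFun (hamField_quadPart lam) (component lam H ω)
    rw [hamField] at this
    rw [this]
    ext d
    rw [coeff_linField, map_smul, coeff_component, smul_eq_mul]
    split_ifs with hd
    · rw [hd.2]
    · rw [mul_zero, mul_zero]
  rw [poisson_jacobi, h, add_sub_cancel_right]
  exact LinearMap.congr_fun (map_smul (poissonBilin ν) ω (component lam H ω)) φ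

theorem jet_linOp_commutator (N : ℕ) (ω : ℂ) :
    jet ν N (linOp lam) * jet ν N (letterOp lam H ω)
      - jet ν N (letterOp lam H ω) * jet ν N (linOp lam) = ω • jet ν N (letterOp lam H ω) := by
  rw [← map_mul, ← map_mul, ← map_sub, linOp_commutator, map_smul]

/-! ### Mould expansions -/

theorem jet_word (N : ℕ) (w : List ℂ) :
    jet ν N (w.map (letterOp lam H)).prod = (w.map fun ω => jet ν N (letterOp lam H ω)).prod := by
  rw [map_list_prod, List.map_map]
  rfl

theorem jet_word_eq_zero {N : ℕ} {w : List ℂ} (hw : N ≤ w.length) :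
    (w.map fun ω => jet ν N (letterOp lam H ω)).prod = 0 := by
  rw [← jet_word]
  refine jet_list_prod_eq_zero ?_ (by rwa [List.length_map])
  intro T hT
  obtain ⟨ω, -, rfl⟩ := List.mem_map.1 hT
  exact raises_letterOp lam H ω

theorem wordFinite_letterOp (N : ℕ) : WordFinite fun ω => jet ν N (letterOp lam H ω) :=
  WordFinite.of_length (locallyFinite_letterOp lam H N) N fun _ => jet_word_eq_zero lam H

theorem locallyFinite_words :
    LocallyFiniteOps fun w : List ℂ => (w.map (letterOp lam H)).prod := fun N =>
  (wordFinite_letterOp lam H N).subset fun w hw => by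
    rw [Function.mem_support, jet_word] at hw
    exact hw

/-- `X_lin + ∑ M^• 𝔇_•`, as a filtered operator. -/
def mouldOp (M : Mould ℂ ℂ) : filtOp ν := linOp lam + (locallyFinite_words lam H).sum M

theorem jet_mouldOp (M : Mould ℂ ℂ) (N : ℕ) :
    jet ν N (mouldOp lam H M) =
      jet ν N (linOp lam) + evalMould (fun ω => jet ν N (letterOp lam H ω)) M := by
  rw [mouldOp, map_add, LocallyFiniteOps.jet_sum, evalMould]
  simp only [jet_word]

theorem wordOp_frakD (w : List (alphabet lam H)) :
    wordOp (frakD lam H) w =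
      ⇑((w.map fun ω : alphabet lam H => letterOp lam H ω).prod).1 := by
  induction w with
  | nil => rfl
  | cons ω w ih =>
    rw [wordOp, ih]
    rfl

theorem onAlphabet_apply (M : Mould ℂ ℂ) (w : List (alphabet lam H)) :
    onAlphabet M w = M (w.map Subtype.val) := by
  simp [onAlphabet, List.map_eq_flatMap]

theorem coe_mouldOp (M : Mould ℂ ℂ) : ⇑(mouldOp lam H M).1 = mouldField lam H M := by
  have h : formalSum (onAlphabet M) (wordOp (frakD lam H)) =
      formalSum M fun w => ⇑((w.map (letterOp lam H)).prod).1 := by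
    rw [← formalSum_comp (e := List.map (Subtype.val : alphabet lam H → ℂ))
      (List.map_injective_iff.2 Subtype.val_injective) M
      (fun w => ⇑((w.map (letterOp lam H)).prod).1)]
    · have e : wordOp (frakD lam H) = fun w : List (alphabet lam H) =>
          ⇑(((w.map Subtype.val).map (letterOp lam H)).prod).1 := by
        funext w
        rw [wordOp_frakD, List.map_map]
        rfl
      rw [e, show onAlphabet M = fun w : List (alphabet lam H) => M (w.map Subtype.val) from
        funext (onAlphabet_apply lam H M)]
    · intro w hw φ
      have : ∃ ω ∈ w, ω ∉ alphabet lam H := by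
        by_contra hn
        push Not at hn
        exact hw ⟨w.attach.map fun a => ⟨a.1, hn a.1 a.2⟩, by simp [Function.comp_def]⟩
      obtain ⟨ω, hω, hn⟩ := this
      rw [List.prod_eq_zero (List.mem_map.2 ⟨ω, hω, letterOp_eq_zero lam H hn⟩)]
      exact smul_zero _
  rw [mouldField, h, ← coe_linOp]
  rfl

theorem formallySummable_words (M : Mould ℂ ℂ) :
    FormallySummable (onAlphabet (lam := lam) (H := H) M) (wordOp (frakD lam H)) := by
  intro φ d
  have hinj : Function.Injective (List.map (Subtype.val : alphabet lam H → ℂ)) :=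
    List.map_injective_iff.2 Subtype.val_injective
  refine (((locallyFinite_words lam H).formallySummable M φ d).preimage hinj.injOn).subset ?_
  intro w hw h
  refine hw ?_
  simp only [List.map_map] at h
  simp only [wordOp_frakD, onAlphabet_apply]
  exact h

theorem formallySummable_letters :
    FormallySummable (fun _ : alphabet lam H => (1 : ℂ)) (frakD lam H) := fun φ d =>
  ((locallyFinite_letterOp lam H).formallySummable (fun _ => 1) φ d).preimage
    Subtype.val_injective.injOn

variable {lam H}

theorem jet_ident (N : ℕ) :
    evalMould (fun ω => jet ν N (letterOp lam H ω)) Mould.ident =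
      jet ν N (scaleOp lam H fun _ => 1) := by
  rw [evalMould_of_letters _ _ ident_eq_zero_of_length, jet_scaleOp]
  rfl

theorem jet_vMould (N : ℕ) :
    evalMould (fun ω => jet ν N (letterOp lam H ω)) vMould =
      jet ν N (scaleOp lam H fun ω => 1 / ω) := by
  rw [evalMould_of_letters _ _ vMould_eq_zero_of_length, jet_scaleOp]
  refine finsum_congr fun ω => ?_
  congr 1
  by_cases h : ω = 0 <;> simp [vMould, h]

theorem weightScale_one_add_quadPart (hH : IsHamiltonian lam H) :
    quadPart lam + weightScale lam H (fun _ => 1) = H := by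
  ext d
  rw [map_add, coeff_weightScale]
  split_ifs with hd
  · rw [coeff_quadPart_eq_zero lam (by omega), zero_add, one_mul]
  · rw [add_zero, hH d (by omega)]

theorem hamOp_eq (hH : IsHamiltonian lam H) :
    hamOp ν ⟨H, hH.mem_ordGE⟩ = linOp lam + scaleOp lam H fun _ => 1 := by
  rw [linOp, scaleOp, ← map_add]
  congr 1
  exact Subtype.ext (weightScale_one_add_quadPart hH).symm

theorem hamOp_eq_mouldOp_ident (hH : IsHamiltonian lam H) :
    hamOp ν ⟨H, hH.mem_ordGE⟩ = mouldOp lam H Mould.ident :=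
  filtOp_ext fun N => by rw [hamOp_eq hH, map_add, jet_mouldOp, jet_ident]

theorem hamField_eq_sum (hH : IsHamiltonian lam H) :
    hamField H = linField lam +
      formalSum (fun _ : alphabet lam H => (1 : ℂ)) (frakD lam H) := by
  rw [← coe_scaleOp_eq_alphabet_sum lam H fun _ => 1, ← coe_linOp]
  change ⇑(hamOp ν ⟨H, hH.mem_ordGE⟩).1 = _
  rw [hamOp_eq hH]
  rfl

/-! ### One simplification -/

theorem simp_eq_exp : simp lam H = ⇑(raises_scaleOp lam H fun ω => 1 / ω).exp.1 := by
  rw [Raises.coe_exp, simp, coe_scaleOp_eq_generator]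

theorem simpInv_eq_exp : simpInv lam H = ⇑(raises_scaleOp lam H fun ω => 1 / ω).neg.exp.1 := by
  rw [Raises.coe_exp, simpInv, neg_scaleOp, ← coe_scaleOp_eq_generator]
  simp only [neg_div]

theorem isHamiltonian_simp (hH : IsHamiltonian lam H) : IsHamiltonian lam (simp lam H H) := by
  rw [isHamiltonian_iff, ← sub_add_sub_cancel _ H, simp_eq_exp]
  exact Submodule.add_mem _
    ((raises_scaleOp lam H fun ω => 1 / ω).exp_sub_self_mem 2 hH.mem_ordGE)
    (isHamiltonian_iff.1 hH)

theorem simp_conj (K : PS ν) :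
    simp lam H ∘ hamField K ∘ simpInv lam H = hamField (simp lam H K) := by
  rw [simp_eq_exp, simpInv_eq_exp]
  exact exp_hamOp_conj (weightScale_mem lam H _) K

theorem simplified_eq_mouldOp_sam (hH : IsHamiltonian lam H) :
    simplified lam H = ⇑(mouldOp lam H sam).1 := by
  have h : mouldOp lam H sam =
      (raises_scaleOp lam H fun ω => 1 / ω).exp * hamOp ν ⟨H, hH.mem_ordGE⟩
        * (raises_scaleOp lam H fun ω => 1 / ω).neg.exp :=
    filtOp_ext fun N => by
      rw [jet_mouldOp, add_evalMould_sam (wordFinite_letterOp lam H N)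
        (jet_linOp_commutator lam H N), hamOp_eq hH, map_mul, map_mul, map_add, Raises.jet_exp,
        Raises.jet_exp, jet_neg, jet_ident, jet_vMould]
  rw [h, simplified, simp_eq_exp, simpInv_eq_exp]
  rfl

/-- If `X_{H'}` has a mould expansion in the operators of `H`, then its homogeneous components are
the homogeneous parts of that expansion: both are eigenvectors of the commutator with `X_lin`, and
the eigenspaces are independent. -/
theorem jet_letterOp_of_mouldOp {H' : PS ν} (hH' : IsHamiltonian lam H') {M : Mould ℂ ℂ}
    (h : hamField H' = ⇑(mouldOp lam H M).1) (N : ℕ) (ω : ℂ) :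
    jet ν N (letterOp lam H' ω) = ∑ᶠ (w : List ℂ) (_ : w.sum = ω),
      M w • (w.map fun ω => jet ν N (letterOp lam H ω)).prod := by
  classical
  set D := fun ω => jet ν N (letterOp lam H ω) with hD
  have hW : WordFinite D := wordFinite_letterOp lam H N
  set D' : ℂ → _ := fun ω => ∑ᶠ (w : List ℂ) (_ : w.sum = ω), M w • (w.map D).prod with hD'
  set D₁ := fun ω => jet ν N (letterOp lam H' ω) with hD₁
  have hop : hamOp ν ⟨H', hH'.mem_ordGE⟩ = mouldOp lam H M :=
    Subtype.ext (DFunLike.coe_injective h)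
  have hsum : ∑ᶠ ω, D₁ ω = ∑ᶠ ω, D' ω := by
    have h1 := congrArg (jet ν N) hop
    rw [hamOp_eq hH', jet_mouldOp, map_add, add_right_inj, jet_scaleOp] at h1
    simp only [one_smul] at h1
    rw [hD₁, h1, hD', finsum_fiberwise List.sum _ (hW.smul_support M), evalMould]
  set ad : Module.End ℂ (Module.End ℂ (PS ν ⧸ ordGE ν N)) :=
    LinearMap.mulLeft ℂ (jet ν N (linOp lam)) - LinearMap.mulRight ℂ (jet ν N (linOp lam)) with had
  have e1 : ∀ ω, D₁ ω ∈ ad.eigenspace ω := fun ω => by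
    rw [Module.End.mem_eigenspace_iff]
    exact jet_linOp_commutator lam H' N ω
  have e2 : ∀ ω, D' ω ∈ ad.eigenspace ω := fun ω => by
    refine finsum_mem_induction (· ∈ ad.eigenspace ω) (Submodule.zero_mem _)
      (fun _ _ hx hy => Submodule.add_mem _ hx hy) fun w hw => Submodule.smul_mem _ _ ?_
    rw [Module.End.mem_eigenspace_iff, ← show w.sum = ω from hw]
    exact commutator_word (jet_linOp_commutator lam H N) w
  have f1 : D₁.support.Finite := locallyFinite_letterOp lam H' N
  have f2 : D'.support.Finite := by
    refine ((hW.smul_support M).image List.sum).subset fun ω hω => ?_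
    by_contra hn
    refine hω (finsum_mem_eq_zero_of_forall_eq_zero fun w hw => ?_)
    by_contra h0
    exact hn ⟨w, h0, hw⟩
  set s := insert ω (f1.toFinset ∪ f2.toFinset) with hs
  refine (iSupIndep_iff_finsetSum_eq_imp_eq _).1 (Module.End.eigenspaces_iSupIndep ad) s D₁ D'
    (fun i _ => ⟨e1 i, e2 i⟩) ?_ ω (Finset.mem_insert_self _ _)
  rw [← finsum_eq_sum_of_support_subset, ← finsum_eq_sum_of_support_subset, hsum]
  · intro x hx
    simp [hs, Function.mem_support.1 hx]
  · intro x hx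
    simp [hs, Function.mem_support.1 hx]

theorem mouldOp_comp_sam {H' : PS ν} (hH : IsHamiltonian lam H) (hH' : IsHamiltonian lam H')
    (h : hamField H' = simplified lam H) (M : Mould ℂ ℂ) :
    mouldOp lam H' M = mouldOp lam H (M.comp sam) :=
  filtOp_ext fun N => by
    rw [jet_mouldOp, jet_mouldOp, evalMould_comp (wordFinite_letterOp lam H N) M sam_nil]
    congr 2
    funext ω
    exact jet_letterOp_of_mouldOp hH' (h.trans (simplified_eq_mouldOp_sam hH)) N ω

/-! ### The simplification sequence -/

theorem IsSimplificationSeq.hamField_eq {Hs : ℕ → PS ν} (hs : IsSimplificationSeq lam H Hs)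
    (r : ℕ) : hamField (Hs r) = ⇑(mouldOp lam H (samIter r)).1 := by
  induction r generalizing H Hs with
  | zero =>
    have h0 := hs.2.1 0
    rw [hs.1] at h0 ⊢
    rw [samIter, ← hamOp_eq_mouldOp_ident h0, coe_hamOp]
  | succ r ih =>
    have h0 := hs.2.1 0
    have h1 := hs.2.2 0
    rw [hs.1] at h0 h1
    rw [ih (H := Hs 1) (Hs := fun n => Hs (n + 1))
      ⟨rfl, fun n => hs.2.1 (n + 1), fun n => hs.2.2 (n + 1)⟩,
      mouldOp_comp_sam h0 (hs.2.1 1) h1, samIter]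

theorem existsUnique_isSimplificationSeq (hH : IsHamiltonian lam H) :
    ∃! Hs : ℕ → PS ν, IsSimplificationSeq lam H Hs := by
  set Hs : ℕ → PS ν := fun r => Nat.rec H (fun _ K => simp lam K K) r with hHs
  have hham : ∀ r, IsHamiltonian lam (Hs r) := fun r => by
    induction r with
    | zero => exact hH
    | succ r ih => exact isHamiltonian_simp ih
  refine ⟨Hs, ⟨rfl, hham, fun r => (simp_conj (Hs r)).symm⟩, fun Ks hK => ?_⟩
  funext r
  induction r with
  | zero => exact hK.1
  | succ r ih =>
    refine (hK.2.1 (r + 1)).eq_of_hamField_eq (hham (r + 1)) ?_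
    rw [hK.2.2 r, ih]
    exact simp_conj (Hs r)

theorem formalLimit_mouldField_tram {Hs : ℕ → PS ν} (hs : IsSimplificationSeq lam H Hs) :
    FormalLimit (fun r => hamField (Hs r)) (mouldField lam H tram) := by
  intro φ d
  filter_upwards [Filter.eventually_ge_atTop (d.degree + 1)] with r hr
  rw [hs.hamField_eq, ← coe_mouldOp, ← sub_eq_zero, ← map_sub]
  refine jet_eq_iff.1 ?_ φ d (Nat.lt_succ_self _)
  rw [jet_mouldOp, jet_mouldOp]
  congr 1
  refine finsum_congr fun w => ?_
  rcases lt_or_ge w.length (d.degree + 1) with h | h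
  · rw [samIter_eq_tram w r (by omega)]
  · rw [jet_word_eq_zero lam H h, smul_zero, smul_zero]

theorem FormalLimit.unique {T : ℕ → Op ν} {S S' : Op ν} (h : FormalLimit T S)
    (h' : FormalLimit T S') : S = S' := by
  funext φ
  ext d
  obtain ⟨r, h1, h2⟩ := ((h φ d).and (h' φ d)).exists
  exact h1.symm.trans h2

theorem isTrimmedForm_iff (hH : IsHamiltonian lam H) (X : Op ν) :
    IsTrimmedForm lam H X ↔ X = mouldField lam H tram := by
  constructor
  · rintro ⟨Hs, hs, hX⟩
    exact hX.unique (formalLimit_mouldField_tram hs)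
  · rintro rfl
    obtain ⟨Hs, hs, -⟩ := existsUnique_isSimplificationSeq hH
    exact ⟨Hs, hs, formalLimit_mouldField_tram hs⟩

end Letters

end HamMould
end

theorem theorem7p6 (ν : ℕ) (lam : Fin ν → ℂ) (H : HamMould.PS ν)
    (hH : HamMould.IsHamiltonian lam H) :
    -- decomposition of `X_H` by the alphabet `Ω(H)`
    (HamMould.FormallySummable (fun _ : HamMould.alphabet lam H => (1 : ℂ))
        (HamMould.frakD lam H) ∧
      HamMould.hamField H = HamMould.linField lam +
        HamMould.formalSum (fun _ : HamMould.alphabet lam H => (1 : ℂ)) (HamMould.frakD lam H)) ∧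
    -- the successive simplifications exist, stay Hamiltonian, and are uniquely determined
    (∃! Hs : ℕ → HamMould.PS ν, HamMould.IsSimplificationSeq lam H Hs) ∧
    -- each of them is a canonical, Hamiltonian-preserving transformation
    (∀ Hs : ℕ → HamMould.PS ν, HamMould.IsSimplificationSeq lam H Hs → ∀ r : ℕ,
      HamMould.IsCanonical (HamMould.simp lam (Hs r)) ∧
      Function.LeftInverse (HamMould.simpInv lam (Hs r)) (HamMould.simp lam (Hs r)) ∧
      Function.RightInverse (HamMould.simpInv lam (Hs r)) (HamMould.simp lam (Hs r)) ∧
      ∀ K : HamMould.PS ν,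
        HamMould.simp lam (Hs r) ∘ HamMould.hamField K ∘ HamMould.simpInv lam (Hs r) =
          HamMould.hamField (HamMould.simp lam (Hs r) K)) ∧
    -- the iterated compositions of `Sam` are stationary, with limit `Tram`
    (∀ (w : List ℂ) (p : ℕ), w.length ≤ p → HamMould.samIter p w = HamMould.tram w) ∧
    -- the trimmed form exists, is unique, and is `X_lin + ∑ Tram^• 𝔇_•`
    HamMould.FormallySummable
      (HamMould.onAlphabet (lam := lam) (H := H) HamMould.tram)
      (HamMould.wordOp (HamMould.frakD lam H)) ∧
    ∀ X : HamMould.Op ν, HamMould.IsTrimmedForm lam H X ↔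
      X = HamMould.mouldField lam H HamMould.tram := by
  open HamMould in
  refine ⟨⟨formallySummable_letters lam H, hamField_eq_sum hH⟩,
    existsUnique_isSimplificationSeq hH, fun Hs hs r => ?_, samIter_eq_tram,
    formallySummable_words lam H tram, isTrimmedForm_iff hH⟩
  have hG := weightScale_mem lam (Hs r) fun ω => 1 / ω
  refine ⟨?_, ?_, ?_, simp_conj⟩
  · rw [simp_eq_exp]
    exact isCanonical_exp_hamOp hG
  · rw [simp_eq_exp, simpInv_eq_exp]
    exact exp_hamOp_leftInverse hG
  · rw [simp_eq_exp, simpInv_eq_exp]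
    exact exp_hamOp_rightInverse hG
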